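/- Let $D$ be an oriented virtual link diagram with at least one component. Virtual link diagrams are taken up to planar isotopy and detour moves, that is, they are given by their Gauss diagrams: finitely many oriented circles with signed arrows (the classical crossings, each directed from its over- to its under-passage) whose endpoints lie at distinct points of the circles. Two diagrams are equivalent if they are related by a finite sequence of Reidemeister moves. The short arcs of $D$ are the pieces of the link between consecutive classical crossings (and the circles without classical crossings). An Alexander numbering is a function $f$ from the short arcs to $\mathbb Z$ such that at every classical crossing, drawn with both strands pointing upwards, the two short arcs on the right have a common number $a$ and the two on the left have the number $a+1$. $D$ is almost classical if it is equivalent to a diagram that has an Alexander numbering. For a state $S$ (a choice of the $A$- or $B$-smoothing at each classical crossing), let $\alpha(S)$, $\beta(S)$ be the numbers of $A$- and $B$-smoothings and $|S|$ the number of loops. At a crossing where the smoothing of $S$ does not respect the orientation (the $B$-smoothing of a positive crossing, the $A$-smoothing of a negative one), each of the two new strands carries one pole: drawn with the crossing pointing upwards, the strand joining the two outgoing ends has its pole on its upper side and the strand joining the two incoming ends has its pole on its lower side. Two neighbouring poles of a loop that lie on the same side of it cancel; $a(C)$ denotes half the number of poles left on the loop $C$ after all possible cancellations. With $K_0=1$,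 put $$\langle\langle D\rangle\rangle=\sum_S A^{\alpha(S)-\beta(S)}(-A^2-A^{-2})^{|S|-1}\prod_{C\in S}K_{a(C)}\in\mathbb Z[A^{\pm1},K_1,K_2,\dots],\qquad V_{DKM}(D)=(-A)^{-3w(D)}\langle\langle D\rangle\rangle,$$ where $w(D)$ is the writhe. The surviving states of $D$ are the monomials $A^mK_{i_1}^{j_1}\cdots K_{i_n}^{j_n}$ that occur with non-zero coefficient in $\langle\langle D\rangle\rangle$; the $k$-degree of such a monomial is $\sum_l i_l j_l$, and $AS(D)$ is the set of $k$-degrees of the surviving states of $D$. **Theorem.** If $D$ is almost classical, then $AS(D)=\{0\}$, and $V_{DKM}(D)$ equals the normalized Kauffman bracket polynomial of $D$ (the Jones polynomial in the variable $A$), $$V_{DKM}(D)=(-A)^{-3w(D)}\sum_S A^{\alpha(S)-\beta(S)}(-A^2-A^{-2})^{|S|-1}.$$ -/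

import Mathlib

open scoped LaurentPolynomial

noncomputable section

namespace VirtualLink

/-- The two strands meeting at a classical crossing. -/
inductive Strand
  | over
  | under
  deriving DecidableEq

instance : Fintype Strand := ⟨{.over, .under}, fun x => by cases x <;> simp⟩

/-- The other strand at the same crossing. -/
def Strand.flip : Strand → Strand
  | .over => .under
  | .under => .over

/-- Position of a half-edge at a crossing with respect to the orientation of its strand:
`inc` enters the crossing, `out` leaves it. -/
inductive Dir
  | inc
  | out
  deriving DecidableEq

instance : Fintype Dir := ⟨{.inc, .out}, fun x => by cases x <;> simp⟩

/-- The opposite direction. -/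
def Dir.flip : Dir → Dir
  | .inc => .out
  | .out => .inc

/-- The two smoothings of a classical crossing. -/
inductive Smoothing
  | A
  | B
  deriving DecidableEq

instance : Fintype Smoothing := ⟨{.A, .B}, fun x => by cases x <;> simp⟩

/-- The two sides of a state curve with respect to a direction of travel. -/
inductive Side
  | left
  | right
  deriving DecidableEq

/-- An oriented virtual link diagram with at least one component, recorded (up to planar isotopy
and detour moves) by its Gauss diagram.

The arrows of the Gauss diagram are the classical crossings, with their signs. The arrow of `c`
has the two endpoints `(c, over)` (its tail) and `(c, under)` (its head). The permutation `next`
sends an arrow endpoint to the following one on its oriented circle, so that the circles carrying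
at least one endpoint are the cycles of `next` (fixed points included).
There are `free` further circles without any endpoint. -/
structure Diagram where
  Crossing : Type
  [fintypeCrossing : Fintype Crossing]
  [decEqCrossing : DecidableEq Crossing]
  sign : Crossing → ℤˣ
  next : Equiv.Perm (Crossing × Strand)
  free : ℕ
  nonempty : Nonempty Crossing ∨ 0 < free

attribute [instance] Diagram.fintypeCrossing Diagram.decEqCrossing

namespace Diagram

/-- Arrow endpoints, i.e. passages of the link through a classical crossing. -/
abbrev Endpoint (D : Diagram) : Type := D.Crossing × Strand

/-- Short arcs: `Sum.inl x` is the arc from the endpoint `x` to the endpoint `D.next x`, and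
`Sum.inr i` is the `i`-th circle without endpoints. -/
abbrev ShortArc (D : Diagram) : Type := D.Endpoint ⊕ Fin D.free

/-- The short arc leaving the crossing at `x`. -/
def outArc (D : Diagram) (x : D.Endpoint) : D.ShortArc := Sum.inl x

/-- The short arc entering the crossing at `x`. -/
def inArc (D : Diagram) (x : D.Endpoint) : D.ShortArc := Sum.inl (D.next.symm x)

/-! ### Alexander numberings -/

/-- An Alexander numbering. At a crossing with both strands directed upwards, let `p` be the strand
running from bottom left to top right (the over-strand at a positive crossing, the under-strand at
a negative one) and `q` the other strand. Then the arcs `p_out`, `q_in` on the right carry some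
number `a` and the arcs `p_in`, `q_out` on the left carry `a + 1`. -/
def IsAlexanderNumbering (D : Diagram) (f : D.ShortArc → ℤ) : Prop :=
  ∀ c : D.Crossing,
    f (D.inArc (c, .over)) = f (D.outArc (c, .under)) ∧
    f (D.outArc (c, .over)) = f (D.inArc (c, .under)) ∧
    f (D.inArc (c, .over)) = f (D.outArc (c, .over)) + (D.sign c : ℤ)

/-- The diagram has an Alexander numbering. -/
def AlexanderNumerable (D : Diagram) : Prop :=
  ∃ f : D.ShortArc → ℤ, D.IsAlexanderNumbering f

/-! ### Reidemeister equivalence -/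

/-- `D` and `D'` are the same Gauss diagram up to renaming. -/
def Iso (D D' : Diagram) : Prop :=
  ∃ φ : D.Crossing ≃ D'.Crossing,
    (∀ c, D'.sign (φ c) = D.sign c) ∧
    (∀ x : D.Endpoint, D'.next (Prod.map φ id x) = Prod.map φ id (D.next x)) ∧
    D.free = D'.free

/-- `D` is obtained from `D'` by erasing the arrows of the crossings in `P`. The map `ι` embeds the
crossings of `D` as the remaining crossings of `D'`, and `π` sends a short arc of `D'` to the
short arc of `D` that it becomes part of: two short arcs of `D'` lie in the same short arc of `D`
exactly if they are joined through erased endpoints. -/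
def IsErasure (D' D : Diagram) (P : Set D'.Crossing) : Prop :=
  ∃ (ι : D.Crossing → D'.Crossing) (π : D'.ShortArc → D.ShortArc),
    Function.Injective ι ∧ Set.range ι = Pᶜ ∧
    (∀ c, D'.sign (ι c) = D.sign c) ∧
    Function.Surjective π ∧
    (∀ c t, π (D'.inArc (ι c, t)) = D.inArc (c, t)) ∧
    (∀ c t, π (D'.outArc (ι c, t)) = D.outArc (c, t)) ∧
    (∀ e e', π e = π e' ↔
      Relation.EqvGen
        (fun a b => ∃ x : D'.Endpoint, x.1 ∈ P ∧ a = D'.inArc x ∧ b = D'.outArc x) e e')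

/-- First Reidemeister move, from `D'` to `D`: an arrow with adjacent endpoints is erased. -/
def Move1 (D' D : Diagram) : Prop :=
  ∃ (c : D'.Crossing) (t : Strand),
    D'.next (c, t) = (c, t.flip) ∧ D'.IsErasure D {c}

/-- Second Reidemeister move, from `D'` to `D`: two arrows of opposite signs, with adjacent tails
and with adjacent heads (in either order), are erased. -/
def Move2 (D' D : Diagram) : Prop :=
  ∃ c d : D'.Crossing,
    c ≠ d ∧ D'.sign c = -D'.sign d ∧
    D'.next (c, .over) = (d, .over) ∧
    (D'.next (c, .under) = (d, .under) ∨ D'.next (d, .under) = (c, .under)) ∧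
    D'.IsErasure D {c, d}

/-- `y` follows `x` (if `δ = 1`), or `x` follows `y` (if `δ = -1`). -/
def Adjacent (D : Diagram) (δ : ℤˣ) (x y : D.Endpoint) : Prop :=
  (δ = 1 ∧ D.next x = y) ∨ (δ = -1 ∧ D.next y = x)

/-- Third Reidemeister move, from `D` to `D'`. A top, a middle and a bottom strand bound a triangle
with vertices `a` (top over middle), `b` (top over bottom), `c` (middle over bottom).
The two endpoints on each of the three strands are adjacent, and the move transposes them.
The last two equations say which orders `x`, `y`, `z` along the three strands and which
signs occur together in a triangle formed by three oriented lines of the plane. -/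
def Move3 (D D' : Diagram) : Prop :=
  ∃ (a b c : D.Crossing) (x y z : ℤˣ),
    a ≠ b ∧ a ≠ c ∧ b ≠ c ∧
    D.Adjacent x (a, .over) (b, .over) ∧
    D.Adjacent y (a, .under) (c, .over) ∧
    D.Adjacent z (b, .under) (c, .under) ∧
    D.sign a * z = D.sign b * y ∧
    D.sign b * y = D.sign c * x ∧
    ∃ φ : D.Crossing ≃ D'.Crossing,
      (∀ v, D'.sign (φ v) = D.sign v) ∧
      D.free = D'.free ∧
      ∀ v : D.Endpoint,
        let τ : Equiv.Perm D.Endpoint :=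
          Equiv.swap (a, .over) (b, .over) * Equiv.swap (a, .under) (c, .over) *
            Equiv.swap (b, .under) (c, .under)
        D'.next (Prod.map φ id v) = Prod.map φ id (τ (D.next (τ.symm v)))

/-- One step between virtual link diagrams. -/
def Move (D D' : Diagram) : Prop :=
  D.Iso D' ∨ D.Move1 D' ∨ D.Move2 D' ∨ D.Move3 D'

/-- Virtual Reidemeister equivalence. -/
def Equivalent (D D' : Diagram) : Prop := Relation.EqvGen Move D D'

/-- The virtual link type of `D` is almost classical: it has an Alexander numerable diagram. -/
def AlmostClassical (D : Diagram) : Prop :=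
  ∃ D₀ : Diagram, D.Equivalent D₀ ∧ D₀.AlexanderNumerable

/-- The sum of the crossing signs. -/
def writhe (D : Diagram) : ℤ := ∑ c, (D.sign c : ℤ)

/-! ### States -/

/-- A state: a choice of smoothing at each classical crossing. -/
abbrev State (D : Diagram) : Type := D.Crossing → Smoothing

/-- The smoothing at `c` is the oriented one: the A-smoothing of a positive or the B-smoothing of a
negative crossing. Otherwise the smoothing joins the two incoming half-edges and the two
outgoing half-edges. -/
def IsOriented (D : Diagram) (s : D.State) (c : D.Crossing) : Prop :=
  (D.sign c = 1 ∧ s c = .A) ∨ (D.sign c = -1 ∧ s c = .B)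

/-- Half-edges: ends of short arcs at the classical crossings. -/
abbrev HalfEdge (D : Diagram) : Type := D.Crossing × Strand × Dir

/-- The short arc containing a half-edge. -/
def arcOf (D : Diagram) : D.HalfEdge → D.ShortArc
  | (c, t, .inc) => D.inArc (c, t)
  | (c, t, .out) => D.outArc (c, t)

/-- The other end of the short arc containing a half-edge. -/
def otherEnd (D : Diagram) : D.HalfEdge → D.HalfEdge
  | (c, t, .out) => ((D.next (c, t)).1, (D.next (c, t)).2, .inc)
  | (c, t, .inc) => ((D.next.symm (c, t)).1, (D.next.symm (c, t)).2, .out)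

open Classical in
/-- The half-edge at the same crossing to which the smoothing in `s` connects a half-edge. -/
def smooth (D : Diagram) (s : D.State) : D.HalfEdge → D.HalfEdge
  | (c, t, d) => if D.IsOriented s c then (c, t.flip, d.flip) else (c, t.flip, d)

/-- The loops of the state `s`: short arcs glued along the smoothings. -/
def Loop (D : Diagram) (s : D.State) : Type :=
  Quot (fun a b : D.ShortArc => ∃ h : D.HalfEdge, a = D.arcOf h ∧ b = D.arcOf (D.smooth s h))

instance (D : Diagram) (s : D.State) : Finite (D.Loop s) := Quot.finite _

instance (D : Diagram) (s : D.State) : Fintype (D.Loop s) := Fintype.ofFinite _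

/-- The number `|S|` of loops. -/
def loopCount (D : Diagram) (s : D.State) : ℕ := Fintype.card (D.Loop s)

/-- The number `α(S)` of A-smoothings. -/
def alpha (D : Diagram) (s : D.State) : ℕ := (Finset.univ.filter fun c => s c = .A).card

/-- The number `β(S)` of B-smoothings. -/
def beta (D : Diagram) (s : D.State) : ℕ := (Finset.univ.filter fun c => s c = .B).card

/-! ### Poles -/

/-- Travelling along a state curve from the half-edge `h`, away from its crossing: pass to the other
end of the short arc and through the smoothing there. -/
def walk (D : Diagram) (s : D.State) (h : D.HalfEdge) : D.HalfEdge :=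
  D.smooth s (D.otherEnd h)

open Classical in
/-- The pole met when travelling into the crossing along the half-edge `h`, if the smoothing there
is not the oriented one; it is recorded by the side on which it sits.

With both strands directed upwards, the disoriented smoothing consists of a cup joining the two
outgoing half-edges, with its pole on the upper side, and a cap joining the two incoming
half-edges, with its pole on the lower side. In both cases a traveller who comes from the strand
running from bottom left to top right has the pole on the right. -/
def pole (D : Diagram) (s : D.State) : D.HalfEdge → Option Side
  | (c, t, _) =>
    if D.IsOriented s c then none
    else if (t = .over ↔ D.sign c = 1) then some .right
    else some .left

/-- The poles met, in order, on going once around the state curve from the half-edge `h`. -/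
def poleWord (D : Diagram) (s : D.State) (h : D.HalfEdge) : List Side :=
  (List.range (Function.minimalPeriod (D.walk s) h)).filterMap
    fun i => D.pole s (D.otherEnd ((D.walk s)^[i] h))

end Diagram

/-- Two neighbouring poles on the same side of a state curve cancel. The words are cyclic, so this
may happen across the base point. -/
def CancelStep (w w' : List Side) : Prop :=
  ∃ σ : Side, w ~r (σ :: σ :: w')

/-- The number of poles left on a curve when no further cancellation is possible. (It does not
depend on the order of the cancellations, and the set below has exactly one element.) -/
def reducedLength (w : List Side) : ℕ :=
  sInf {n | ∃ w', Relation.ReflTransGen CancelStep w w' ∧ (∀ w'', ¬ CancelStep w' w'') ∧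
    w'.length = n}

namespace Diagram

/-- `a(C)`: half the number of poles on the loop `C` after reduction. Circles without classical
crossings carry no poles. (Neither the base point nor the direction of travel matters.) -/
def poleNumber (D : Diagram) (s : D.State) (C : D.Loop s) : ℕ :=
  match Quot.out C with
  | Sum.inl x => reducedLength (D.poleWord s (x.1, x.2, .out)) / 2
  | Sum.inr _ => 0

/-! ### The polynomials -/

/-- The unit `-A` of `ℤ[A, A⁻¹]`. -/
def negA : ℤ[T;T⁻¹]ˣ where
  val := -LaurentPolynomial.T 1
  inv := -LaurentPolynomial.T (-1)
  val_inv := by rw [neg_mul_neg, ← LaurentPolynomial.T_add]; simp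
  inv_val := by rw [neg_mul_neg, ← LaurentPolynomial.T_add]; simp

/-- The loop value `-A² - A⁻²`. -/
def loopValue : ℤ[T;T⁻¹] := -LaurentPolynomial.T 2 - LaurentPolynomial.T (-2)

/-- The ring `ℤ[A^{±1}, K₁, K₂, …]`. -/
abbrev ArrowRing : Type := MvPolynomial ℕ+ ℤ[T;T⁻¹]

/-- The variables `K_i`, with `K_0 = 1`. -/
def K (i : ℕ) : ArrowRing := if h : 0 < i then MvPolynomial.X ⟨i, h⟩ else 1

/-- The factor `A^{α(S) - β(S)} (-A² - A⁻²)^{|S| - 1}`. -/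
def stateWeight (D : Diagram) (s : D.State) : ℤ[T;T⁻¹] :=
  LaurentPolynomial.T ((D.alpha s : ℤ) - D.beta s) * loopValue ^ (D.loopCount s - 1)

/-- The Kauffman bracket polynomial. -/
def kauffmanBracket (D : Diagram) : ℤ[T;T⁻¹] := ∑ s : D.State, D.stateWeight s

/-- The normalized Kauffman bracket polynomial, which is the Jones polynomial in the variable `A`
(with `t = A⁻⁴`). -/
def normalizedKauffmanBracket (D : Diagram) : ℤ[T;T⁻¹] :=
  (negA ^ (-3 * D.writhe) : ℤ[T;T⁻¹]ˣ) * D.kauffmanBracket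

/-- The evaluation `[S]` of the arrow state given by `s`. -/
def evaluation (D : Diagram) (s : D.State) : ArrowRing :=
  ∏ C : D.Loop s, K (D.poleNumber s C)

/-- The Dye-Kauffman-Miyazawa bracket. -/
def dkmBracket (D : Diagram) : ArrowRing :=
  ∑ s : D.State, MvPolynomial.C (D.stateWeight s) * D.evaluation s

/-- The Dye-Kauffman-Miyazawa polynomial. -/
def dkmPolynomial (D : Diagram) : ArrowRing :=
  MvPolynomial.C ((negA ^ (-3 * D.writhe) : ℤ[T;T⁻¹]ˣ) : ℤ[T;T⁻¹]) * D.dkmBracket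

/-- `A^m K^μ` is a surviving state: it occurs as a summand of the bracket, after collecting
terms. -/
def IsSurvivingState (D : Diagram) (m : ℤ) (μ : ℕ+ →₀ ℕ) : Prop :=
  (MvPolynomial.coeff μ D.dkmBracket).coeff m ≠ 0

/-- The `k`-degree `∑ i_l · j_l` of `A^m K_{i_1}^{j_1} ⋯ K_{i_n}^{j_n}`. -/
def kDegree (μ : ℕ+ →₀ ℕ) : ℕ := μ.sum fun i j => (i : ℕ) * j

/-- The set of `k`-degrees of the surviving states. -/
def AS (D : Diagram) : Set ℕ :=
  {k | ∃ (m : ℤ) (μ : ℕ+ →₀ ℕ), D.IsSurvivingState m μ ∧ kDegree μ = k}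

end Diagram

end VirtualLink

end

/-! The proof uses a state sum twisted by a permutation. Let `Y` be a finite set of colors with `|Y|
= -A² - A⁻²` for a complex unit `A`, and let `T` be a permutation of `Y`. Color the short arcs by
`Y`. At a crossing, the oriented smoothing requires equal colors on the joined half-edges, while the
disoriented one requires colors that differ by `T` or its inverse. Summing the product of the
crossing weights over all colorings gives `stateSum`.

Three facts carry the argument. First, a Reidemeister move changes the state sum only by a non-zero
factor that does not depend on `T` (`Move.stateSum_eq`). Locally an Alexander numbering exists, so
the twist can be absorbed into the colors of the inner arcs, and the identities of the untwisted
model remain. Second, a global Alexander numbering `f` removes the twist altogether: recoloring each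
arc `e` by `T ^ f e` turns the sum for `T` into the sum for `1`. Hence the sum is independent of `T`
for every almost classical diagram (`AlmostClassical.stateSum_eq`).

Third, expand the state sum over states (`stateSum_eq_sum_states`). Going once around a loop `C`
transports colors by `T` to the alternating sum of its poles. Cancellation preserves that sum up to
sign, so its absolute value is `2 a(C)`, and the loop contributes the number of fixed points of `T ^
(2 a(C))`. Thus the state sum is, up to the factor `|Y|`, the arrow bracket with `K_a` replaced by
`|Fix T^(2a)| / |Y|`, and for `T = 1` it is the Kauffman bracket.

Permutations with prescribed numbers of cycles of length `2d` realize divisor sums as fixed point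
counts. By Möbius inversion these values suffice to detect a polynomial in the `K_a`, and infinitely
many `A` occur with the same values. So the two brackets agree identically. Finally `AS` is not
empty because the Kauffman bracket is non-zero, as its value at `A = -1` modulo `3` shows. -/

open scoped LaurentPolynomial

noncomputable section
namespace VirtualLink

/-! ### Untwisted coloring model of the Kauffman bracket -/

section PlanarWeight

variable {R Y : Type*} [Field R] [DecidableEq Y]

/-- The weight of a crossing in the coloring model of the Kauffman bracket: the smoothing respecting
the orientation has weight `a`, the other one has weight `b`, and a smoothing is compatible with the
colors of the four half-edges if it joins half-edges of the same color. -/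
def planarWeight (a b : R) (io iu oo ou : Y) : R :=
  a * ((if io = ou then 1 else 0) * (if iu = oo then 1 else 0)) +
    b * ((if io = iu then 1 else 0) * (if oo = ou then 1 else 0))

theorem planarWeight_rev_over (a b : R) (io iu oo ou : Y) :
    planarWeight a b io iu oo ou = planarWeight b a oo iu io ou := by
  simp only [planarWeight, eq_comm (a := iu)]; ring

theorem planarWeight_rev_under (a b : R) (io iu oo ou : Y) :
    planarWeight a b io iu oo ou = planarWeight b a io ou oo iu := by
  simp only [planarWeight, eq_comm (a := oo)]; ring

theorem planarWeight_map (e : Y ≃ Y) (a b : R) (io iu oo ou : Y) :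
    planarWeight a b (e io) (e iu) (e oo) (e ou) = planarWeight a b io iu oo ou := by
  simp [planarWeight]

/-- Turns indicators into opaque ring elements, so that the expanded identities below become
polynomial ones. -/
theorem exists_ite_zero_eq_mul :
    ∃ ind : Prop → R, ∀ (p : Prop) [Decidable p] (x : R), (if p then x else 0) = ind p * x := by
  classical
  refine ⟨fun p => if p then 1 else 0, fun p _ x => ?_⟩
  by_cases h : p <;> simp [h]

variable [Fintype Y]

theorem sum_planarWeight_kink_over {a b : R} (hab : a * b = 1)
    (hY : (Fintype.card Y : R) = -a ^ 2 - b ^ 2) (i o : Y) :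
    ∑ e, planarWeight a b i e e o = -a ^ 3 * if i = o then 1 else 0 := by
  simp only [planarWeight, Finset.sum_add_distrib, ← Finset.mul_sum]
  simp [hY]
  split_ifs
  · linear_combination (-b) * hab
  · simp

theorem sum_planarWeight_kink_under {a b : R} (hab : a * b = 1)
    (hY : (Fintype.card Y : R) = -a ^ 2 - b ^ 2) (i o : Y) :
    ∑ e, planarWeight a b e i o e = -a ^ 3 * if i = o then 1 else 0 := by
  simp only [planarWeight, Finset.sum_add_distrib, ← Finset.mul_sum]
  simp [hY, eq_comm (a := o)]
  split_ifs
  · linear_combination (-b) * hab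
  · simp

/-- Besides the desired pairing with coefficient `a * b`, only the turn-back pairing appears. Its
coefficient `a² + b² + a b |Y|` vanishes. -/
theorem sum_planarWeight_bigon {a b : R} (hab : a * b = 1)
    (hY : (Fintype.card Y : R) = -a ^ 2 - b ^ 2) (p q i o : Y) :
    ∑ e, ∑ f, planarWeight a b p i e f * planarWeight b a e f q o =
      (if p = q then 1 else 0) * if i = o then 1 else 0 := by
  obtain ⟨ind, hind⟩ := exists_ite_zero_eq_mul (R := R)
  simp only [planarWeight, mul_add, add_mul, Finset.sum_add_distrib, ite_mul, mul_ite,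
    mul_one, zero_mul, mul_zero, Finset.sum_ite_eq, Finset.sum_ite_eq', Finset.mem_univ, if_true,
    Finset.sum_const_zero, Finset.sum_ite_irrel, ite_add_zero, Finset.sum_const, Finset.card_univ,
    nsmul_eq_mul, hY, eq_comm (a := o)]
  simp only [hind]
  linear_combination
    (ind (i = o) * ind (p = q) + ind (q = o) * ind (p = i) * (-a ^ 2 - b ^ 2)) * hab

/-- After the inner colors are summed out, the two sides differ only in the coefficients of two
pairings of the six ends, and there by a multiple of `a * b - 1`. -/
theorem planarWeight_yang_baxter {a b : R} (hab : a * b = 1)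
    (hY : (Fintype.card Y : R) = -a ^ 2 - b ^ 2) (t₀ t₂ m₀ m₂ b₀ b₂ : Y) :
    ∑ t, ∑ m, ∑ d, planarWeight a b t₀ m₀ t m * planarWeight a b t b₀ t₂ d *
        planarWeight a b m d m₂ b₂ =
      ∑ t, ∑ m, ∑ d, planarWeight a b t m t₂ m₂ * planarWeight a b t₀ d t b₂ *
        planarWeight a b m₀ b₀ m d := by
  obtain ⟨ind, hind⟩ := exists_ite_zero_eq_mul (R := R)
  simp only [planarWeight, mul_add, add_mul, Finset.sum_add_distrib, ite_mul, mul_ite,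
    mul_one, zero_mul, mul_zero, Finset.sum_ite_eq, Finset.sum_ite_eq', Finset.mem_univ, if_true,
    Finset.sum_const_zero, Finset.sum_ite_irrel, ite_add_zero, Finset.sum_const, Finset.card_univ,
    nsmul_eq_mul, hY, eq_comm (a := b₂)]
  simp only [hind]
  linear_combination (ind (m₀ = b₀) * ind (t₀ = b₂) * ind (t₂ = m₂) -
    ind (m₂ = b₂) * ind (b₀ = t₂) * ind (t₀ = m₀)) * (a ^ 2 * b + b ^ 3) * hab

end PlanarWeight

/-! ### Twisted crossing weights and their Reidemeister identities -/

section CrossingWeight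

variable {R Y : Type*} [Field R] [DecidableEq Y]

/-- The weight of a crossing of sign `ε` in the twisted coloring model: along the smoothing which
does not respect the orientation, colors are transported by `T` or its inverse. -/
def crossingWeight (A : Rˣ) (T : Equiv.Perm Y) (ε : ℤˣ) (io iu oo ou : Y) : R :=
  planarWeight ((A ^ (ε : ℤ) : Rˣ) : R) ((A ^ (-(ε : ℤ)) : Rˣ) : R)
    io ((T ^ (ε : ℤ)) iu) ((T ^ (ε : ℤ)) oo) ou

/-- The weight of a crossing in terms of directions of travel along its strands; these are the
orientations where the sign is `1`. -/
def directedWeight (A : Rˣ) (T : Equiv.Perm Y) (x y ε : ℤˣ) (o₀ o₁ u₀ u₁ : Y) : R :=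
  crossingWeight A T ε (if x = 1 then o₀ else o₁) (if y = 1 then u₀ else u₁)
    (if x = 1 then o₁ else o₀) (if y = 1 then u₁ else u₀)

theorem planarWeight_zpow (T : Equiv.Perm Y) (a b : R) (p i j k l : ℤ) (io iu oo ou : Y) :
    planarWeight a b ((T ^ (p + i)) io) ((T ^ (p + j)) iu) ((T ^ (p + k)) oo) ((T ^ (p + l)) ou) =
      planarWeight a b ((T ^ i) io) ((T ^ j) iu) ((T ^ k) oo) ((T ^ l) ou) := by
  simp only [zpow_add, Equiv.Perm.mul_apply, planarWeight_map]

/-- A local Alexander numbering at the crossing: `p` and `q` are the levels of the arcs before it on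
the over- and under-strand, and shifting each color by its level leaves an untwisted weight.
Reversing a strand exchanges the two smoothings, hence the exponent `x * y * ε`. -/
theorem directedWeight_eq (A : Rˣ) (T : Equiv.Perm Y) (x y ε : ℤˣ) (o₀ o₁ u₀ u₁ : Y)
    (p q : ℤ) (hpq : 2 * q = 2 * p + (x + y) * ε) :
    directedWeight A T x y ε o₀ o₁ u₀ u₁ =
      planarWeight ((A ^ (x * y * ε : ℤ) : Rˣ) : R) ((A ^ (-(x * y * ε : ℤ)) : Rˣ) : R)
        ((T ^ p) o₀) ((T ^ q) u₀) ((T ^ (p + x * ε)) o₁) ((T ^ (q - y * ε)) u₁) := by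
  obtain rfl | rfl := Int.units_eq_one_or x <;> obtain rfl | rfl := Int.units_eq_one_or y
  · obtain rfl : q = p + ε := by push_cast at hpq; linarith
    have := planarWeight_zpow T ((A ^ (ε : ℤ) : Rˣ) : R) ((A ^ (-(ε : ℤ)) : Rˣ) : R) p 0 ε ε 0
      o₀ u₀ o₁ u₁
    simp_all [directedWeight, crossingWeight]
  · obtain rfl : q = p := by push_cast at hpq; linarith
    have := planarWeight_zpow T ((A ^ (ε : ℤ) : Rˣ) : R) ((A ^ (-(ε : ℤ)) : Rˣ) : R) q 0 ε ε 0
      o₀ u₁ o₁ u₀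
    simp_all [directedWeight, crossingWeight, planarWeight_rev_under (iu := (T ^ q) u₀)]
  · obtain rfl : q = p := by push_cast at hpq; linarith
    have := planarWeight_zpow T ((A ^ (ε : ℤ) : Rˣ) : R) ((A ^ (-(ε : ℤ)) : Rˣ) : R) (q - ε) 0 ε ε 0
      o₁ u₀ o₀ u₁
    simp_all [directedWeight, crossingWeight, planarWeight_rev_over (io := (T ^ q) o₀), sub_eq_add_neg]
  · obtain rfl : p = q + ε := by push_cast at hpq; linarith
    have := planarWeight_zpow T ((A ^ (ε : ℤ) : Rˣ) : R) ((A ^ (-(ε : ℤ)) : Rˣ) : R) q 0 ε ε 0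
      o₁ u₁ o₀ u₀
    simp_all [directedWeight, crossingWeight, planarWeight_rev_over (io := (T ^ (q + (ε : ℤ))) o₀),
      planarWeight_rev_under (iu := (T ^ q) u₀)]

variable [Fintype Y] {A : Rˣ}

theorem sum_comp_two (F : Y → Y → R) (e₁ e₂ : Equiv.Perm Y) :
    ∑ t, ∑ m, F (e₁ t) (e₂ m) = ∑ t, ∑ m, F t m :=
  (Finset.sum_congr rfl fun t _ => Equiv.sum_comp e₂ fun m => F (e₁ t) m).trans
    (Equiv.sum_comp e₁ fun t => ∑ m, F t m)

theorem sum_comp_three (F : Y → Y → Y → R) (e₁ e₂ e₃ : Equiv.Perm Y) :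
    ∑ t, ∑ m, ∑ d, F (e₁ t) (e₂ m) (e₃ d) = ∑ t, ∑ m, ∑ d, F t m d :=
  (Finset.sum_congr rfl fun t _ => sum_comp_two (fun m d => F (e₁ t) m d) e₂ e₃).trans
    (Equiv.sum_comp e₁ fun t => ∑ m, ∑ d, F t m d)

theorem card_eq_units_zpow
    (hY : (Fintype.card Y : R) = -(A : R) ^ 2 - ((A⁻¹ : Rˣ) : R) ^ 2) (ε : ℤˣ) :
    (Fintype.card Y : R) =
      -((A ^ (ε : ℤ) : Rˣ) : R) ^ 2 - ((A ^ (-(ε : ℤ)) : Rˣ) : R) ^ 2 := by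
  obtain rfl | rfl := Int.units_eq_one_or ε
  · simpa using hY
  · simp only [hY, Units.val_neg, Units.val_one, neg_neg, zpow_neg, zpow_one]; ring

theorem units_zpow_mul_zpow_neg (n : ℤ) :
    ((A ^ n : Rˣ) : R) * ((A ^ (-n) : Rˣ) : R) = 1 := by
  rw [← Units.val_mul, ← zpow_add, add_neg_cancel, zpow_zero, Units.val_one]

theorem units_zpow_neg_mul_zpow (n : ℤ) :
    ((A ^ (-n) : Rˣ) : R) * ((A ^ n : Rˣ) : R) = 1 := by
  rw [mul_comm, units_zpow_mul_zpow_neg]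

theorem sum_crossingWeight_kink_over (T : Equiv.Perm Y)
    (hY : (Fintype.card Y : R) = -(A : R) ^ 2 - ((A⁻¹ : Rˣ) : R) ^ 2) (ε : ℤˣ) (i o : Y) :
    ∑ e, crossingWeight A T ε i e e o =
      -((A ^ (ε : ℤ) : Rˣ) : R) ^ 3 * if i = o then 1 else 0 := by
  rw [← sum_planarWeight_kink_over (units_zpow_mul_zpow_neg _) (card_eq_units_zpow hY ε)]
  exact Equiv.sum_comp (T ^ (ε : ℤ)) fun e => planarWeight _ _ i e e o

theorem sum_crossingWeight_kink_under (T : Equiv.Perm Y)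
    (hY : (Fintype.card Y : R) = -(A : R) ^ 2 - ((A⁻¹ : Rˣ) : R) ^ 2) (ε : ℤˣ) (i o : Y) :
    ∑ e, crossingWeight A T ε e i o e =
      -((A ^ (ε : ℤ) : Rˣ) : R) ^ 3 * if i = o then 1 else 0 := by
  simp only [crossingWeight, sum_planarWeight_kink_under (units_zpow_mul_zpow_neg _)
    (card_eq_units_zpow hY ε), EmbeddingLike.apply_eq_iff_eq]

/-- A common shift of all four colors moves the twist to the other two half-edges. In a bigon, both
crossings then twist the inner arcs in the same way. -/
theorem crossingWeight_neg (T : Equiv.Perm Y) (ε : ℤˣ) (io iu oo ou : Y) :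
    crossingWeight A T (-ε) io iu oo ou =
      planarWeight ((A ^ (-(ε : ℤ)) : Rˣ) : R) ((A ^ (ε : ℤ) : Rˣ) : R)
        ((T ^ (ε : ℤ)) io) iu oo ((T ^ (ε : ℤ)) ou) := by
  have := planarWeight_zpow T ((A ^ (-(ε : ℤ)) : Rˣ) : R) ((A ^ (ε : ℤ) : Rˣ) : R) (-ε) ε 0 0 ε
    io iu oo ou
  simp_all [crossingWeight]

theorem sum_crossingWeight_bigon (T : Equiv.Perm Y)
    (hY : (Fintype.card Y : R) = -(A : R) ^ 2 - ((A⁻¹ : Rˣ) : R) ^ 2) (ε : ℤˣ) (p q i o : Y) :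
    ∑ e, ∑ f, crossingWeight A T ε p i e f * crossingWeight A T (-ε) e f q o =
      (if p = q then 1 else 0) * if i = o then 1 else 0 := by
  simp only [crossingWeight_neg]
  refine (Equiv.sum_comp (T ^ (ε : ℤ)) fun e => ∑ f, planarWeight _ _ p ((T ^ (ε : ℤ)) i) e f *
    planarWeight _ _ e f q ((T ^ (ε : ℤ)) o)).trans ?_
  rw [sum_planarWeight_bigon (units_zpow_mul_zpow_neg _) (card_eq_units_zpow hY ε)]
  simp only [EmbeddingLike.apply_eq_iff_eq]

theorem sum_crossingWeight_bigon_antiparallel (T : Equiv.Perm Y)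
    (hY : (Fintype.card Y : R) = -(A : R) ^ 2 - ((A⁻¹ : Rˣ) : R) ^ 2) (ε : ℤˣ) (p q i o : Y) :
    ∑ e, ∑ f, crossingWeight A T ε p f e o * crossingWeight A T (-ε) e i q f =
      (if p = q then 1 else 0) * if i = o then 1 else 0 := by
  have hY' : (Fintype.card Y : R) =
      -((A ^ (-(ε : ℤ)) : Rˣ) : R) ^ 2 - ((A ^ (ε : ℤ) : Rˣ) : R) ^ 2 := by
    rw [card_eq_units_zpow hY ε]; ring
  have key := sum_planarWeight_bigon (units_zpow_neg_mul_zpow _) hY' p q o i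
  simp only [eq_comm (a := i)]
  rw [← key]
  refine Eq.trans ?_ (sum_comp_two _ (T ^ (ε : ℤ)) (T ^ (ε : ℤ)))
  refine Finset.sum_congr rfl fun e _ => Finset.sum_congr rfl fun f _ => ?_
  rw [crossingWeight_neg, crossingWeight, planarWeight_rev_under,
    planarWeight_rev_under (io := (T ^ (ε : ℤ)) e)]

/-- The letters `g`, `k`, `l` are levels on the top, middle and bottom strand. The outer levels
agree before and after the move, so both sides become untwisted sums with the same outer colors. The
shifts of the inner colors disappear by reindexing, and `planarWeight_yang_baxter` applies. -/
theorem sum_directedWeight_triangle_of_levels (T : Equiv.Perm Y)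
    (hY : (Fintype.card Y : R) = -(A : R) ^ 2 - ((A⁻¹ : Rˣ) : R) ^ 2) {x y z α β γ η : ℤˣ}
    (hα : x * y * α = η) (hβ : x * z * β = η) (hγ : y * z * γ = η)
    {g₀ g₁ g₂ k₀ k₁ k₂ l₀ l₁ l₂ g k l : ℤ}
    (h₁ : 2 * k₀ = 2 * g₀ + (x + y) * α) (h₂ : g₁ = g₀ + x * α) (h₃ : k₁ = k₀ - y * α)
    (h₄ : 2 * l₀ = 2 * g₁ + (x + z) * β) (h₅ : g₂ = g₁ + x * β) (h₆ : l₁ = l₀ - z * β)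
    (h₇ : 2 * l₁ = 2 * k₁ + (y + z) * γ) (h₈ : k₂ = k₁ + y * γ) (h₉ : l₂ = l₁ - z * γ)
    (h₁' : 2 * k = 2 * g + (x + y) * α) (h₂' : g₂ = g + x * α) (h₃' : k₂ = k - y * α)
    (h₄' : 2 * l = 2 * g₀ + (x + z) * β) (h₅' : g = g₀ + x * β) (h₆' : l₂ = l - z * β)
    (h₇' : 2 * l₀ = 2 * k₀ + (y + z) * γ) (h₈' : k = k₀ + y * γ) (h₉' : l = l₀ - z * γ)
    (t₀ t₂ m₀ m₂ b₀ b₂ : Y) :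
    ∑ t, ∑ m, ∑ d, directedWeight A T x y α t₀ t m₀ m * directedWeight A T x z β t t₂ b₀ d *
        directedWeight A T y z γ m m₂ d b₂ =
      ∑ t, ∑ m, ∑ d, directedWeight A T x y α t t₂ m m₂ * directedWeight A T x z β t₀ t d b₂ *
        directedWeight A T y z γ m₀ m b₀ d := by
  have hα' : (x * y * α : ℤ) = η := by exact_mod_cast congrArg Units.val hα
  have hβ' : (x * z * β : ℤ) = η := by exact_mod_cast congrArg Units.val hβ
  have hγ' : (y * z * γ : ℤ) = η := by exact_mod_cast congrArg Units.val hγ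
  have hL (t m d) : directedWeight A T x y α t₀ t m₀ m * directedWeight A T x z β t t₂ b₀ d *
      directedWeight A T y z γ m m₂ d b₂ = _ :=
    congrArg₂ (· * ·) (congrArg₂ (· * ·) (directedWeight_eq A T x y α _ _ _ _ _ _ h₁)
      (directedWeight_eq A T x z β _ _ _ _ _ _ h₄)) (directedWeight_eq A T y z γ _ _ _ _ _ _ h₇)
  have hR (t m d) : directedWeight A T x y α t t₂ m m₂ * directedWeight A T x z β t₀ t d b₂ *
      directedWeight A T y z γ m₀ m b₀ d = _ :=
    congrArg₂ (· * ·) (congrArg₂ (· * ·) (directedWeight_eq A T x y α _ _ _ _ _ _ h₁')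
      (directedWeight_eq A T x z β _ _ _ _ _ _ h₄')) (directedWeight_eq A T y z γ _ _ _ _ _ _ h₇')
  simp only [hL, hR, hα', hβ', hγ', ← h₂, ← h₃, ← h₅, ← h₆, ← h₈, ← h₉, ← h₂', ← h₃', ← h₅', ← h₆',
    ← h₈', ← h₉']
  have key := planarWeight_yang_baxter (units_zpow_mul_zpow_neg _) (card_eq_units_zpow hY η)
    ((T ^ g₀) t₀) ((T ^ g₂) t₂) ((T ^ k₀) m₀) ((T ^ k₂) m₂) ((T ^ l₀) b₀) ((T ^ l₂) b₂)
  exact (sum_comp_three (fun t m d => planarWeight _ _ ((T ^ g₀) t₀) ((T ^ k₀) m₀) t m *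
    planarWeight _ _ t ((T ^ l₀) b₀) ((T ^ g₂) t₂) d *
    planarWeight _ _ m d ((T ^ k₂) m₂) ((T ^ l₂) b₂)) _ _ _).trans (key.trans
    (sum_comp_three (fun t m d => planarWeight _ _ t m ((T ^ g₂) t₂) ((T ^ k₂) m₂) *
    planarWeight _ _ ((T ^ g₀) t₀) d t ((T ^ l₂) b₂) *
    planarWeight _ _ ((T ^ k₀) m₀) ((T ^ l₀) b₀) m d) _ _ _).symm)

/-- The sign conditions say that, relative to the directions of travel, all three crossings have the
same sign `η`. -/
theorem sum_directedWeight_triangle (T : Equiv.Perm Y)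
    (hY : (Fintype.card Y : R) = -(A : R) ^ 2 - ((A⁻¹ : Rˣ) : R) ^ 2) {x y z α β γ : ℤˣ}
    (hαβ : α * z = β * y) (hβγ : β * y = γ * x) (t₀ t₂ m₀ m₂ b₀ b₂ : Y) :
    ∑ t, ∑ m, ∑ d, directedWeight A T x y α t₀ t m₀ m * directedWeight A T x z β t t₂ b₀ d *
        directedWeight A T y z γ m m₂ d b₂ =
      ∑ t, ∑ m, ∑ d, directedWeight A T x y α t t₂ m m₂ * directedWeight A T x z β t₀ t d b₂ *
        directedWeight A T y z γ m₀ m b₀ d := by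
  obtain rfl : β = α * z * y := by rw [hαβ, mul_assoc, Int.units_mul_self, mul_one]
  obtain rfl : γ = α * z * x := by rw [hαβ, hβγ, mul_assoc, Int.units_mul_self, mul_one]
  -- The levels come from putting `0` on the first top arc and propagating through the triangle. The
  -- divisions by `2` are exact, since a sum of two signs is even.
  apply sum_directedWeight_triangle_of_levels T hY (η := x * y * α)
    (g₀ := 0) (g₁ := x * α) (g₂ := x * α + x * z * y * α) (k₀ := (x + y) / 2 * α)
    (k₁ := (x + y) / 2 * α - y * α) (k₂ := (x + y) / 2 * α - y * α + y * z * x * α)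
    (l₀ := x * α + (x + z) / 2 * z * y * α) (l₁ := x * α + (x + z) / 2 * z * y * α - y * α)
    (l₂ := x * α + (x + z) / 2 * z * y * α - y * α - x * α) (g := x * z * y * α)
    (k := (x + y) / 2 * α + y * z * x * α) (l := x * α + (x + z) / 2 * z * y * α - x * α)
  all_goals
    obtain rfl | rfl := Int.units_eq_one_or x <;> obtain rfl | rfl := Int.units_eq_one_or y <;>
      obtain rfl | rfl := Int.units_eq_one_or z <;> push_cast <;> norm_num <;> try ring

end CrossingWeight

/-! ### Summing over the color of a single arc -/

section Update

variable {X Y R : Type*} [Fintype X] [DecidableEq X] [Fintype Y] [CommSemiring R]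

theorem sum_sum_update (e : X) (G : (X → Y) → R) :
    ∑ col, ∑ y, G (Function.update col e y) = Fintype.card Y * ∑ col, G col := by
  -- Exchanging the spare color with the color of `e` is an involution, after which the spare color
  -- is free and yields the factor `|Y|`.
  let E : (X → Y) × Y ≃ (X → Y) × Y := Function.Involutive.toPerm
    (fun q => (Function.update q.1 e q.2, q.1 e)) fun q => by simp
  rw [← Fintype.sum_prod_type' (f := fun col y => G (Function.update col e y))]
  refine (Equiv.sum_comp E fun q => G q.1).trans ?_
  rw [Fintype.sum_prod_type]
  simp [Finset.mul_sum]

theorem card_mul_sum_mul (e : X) {L r : (X → Y) → R}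
    (hr : ∀ col y, r (Function.update col e y) = r col) :
    Fintype.card Y * ∑ col, L col * r col =
      ∑ col, (∑ y, L (Function.update col e y)) * r col := by
  rw [← sum_sum_update e]
  simp only [hr, Finset.sum_mul]

end Update

section UpdateField

variable {X Y R : Type*} [Fintype X] [DecidableEq X] [Fintype Y] [Nonempty Y] [Field R] [CharZero R]

/-- Two sums over colorings agree if they agree after summation over the color of `e`. -/
theorem sum_mul_congr_update (e : X) {L L' r : (X → Y) → R}
    (hr : ∀ col y, r (Function.update col e y) = r col)
    (h : ∀ col, ∑ y, L (Function.update col e y) = ∑ y, L' (Function.update col e y)) :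
    ∑ col, L col * r col = ∑ col, L' col * r col := by
  apply mul_left_cancel₀ (show (Fintype.card Y : R) ≠ 0 by simp)
  simp only [card_mul_sum_mul e hr, h]

theorem sum_mul_congr_update_two (e f : X) {L L' r : (X → Y) → R}
    (hre : ∀ col y, r (Function.update col e y) = r col)
    (hrf : ∀ col y, r (Function.update col f y) = r col)
    (h : ∀ col, ∑ y, ∑ z, L (Function.update (Function.update col e y) f z) =
      ∑ y, ∑ z, L' (Function.update (Function.update col e y) f z)) :
    ∑ col, L col * r col = ∑ col, L' col * r col := by
  apply mul_left_cancel₀ (show (Fintype.card Y : R) ≠ 0 by simp)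
  simp only [card_mul_sum_mul f hrf]
  exact sum_mul_congr_update e hre h

theorem sum_mul_congr_update_three (e f g : X) {L L' r : (X → Y) → R}
    (hre : ∀ col y, r (Function.update col e y) = r col)
    (hrf : ∀ col y, r (Function.update col f y) = r col)
    (hrg : ∀ col y, r (Function.update col g y) = r col)
    (h : ∀ col, ∑ x, ∑ y, ∑ z,
        L (Function.update (Function.update (Function.update col e x) f y) g z) =
      ∑ x, ∑ y, ∑ z, L' (Function.update (Function.update (Function.update col e x) f y) g z)) :
    ∑ col, L col * r col = ∑ col, L' col * r col := by
  apply mul_left_cancel₀ (show (Fintype.card Y : R) ≠ 0 by simp)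
  simp only [card_mul_sum_mul g hrg]
  exact sum_mul_congr_update_two e f hre hrf h

end UpdateField

namespace Diagram

/-! ### The twisted state sum and Alexander numberings -/

section StateSum

variable {R Y : Type*} [Field R] [DecidableEq Y]

/-- The weight at the crossing `c` of a coloring of the short arcs. -/
def weightAt (D : Diagram) (A : Rˣ) (T : Equiv.Perm Y) (col : D.ShortArc → Y) (c : D.Crossing) : R :=
  crossingWeight A T (D.sign c) (col (D.inArc (c, .over))) (col (D.inArc (c, .under)))
    (col (D.outArc (c, .over))) (col (D.outArc (c, .under)))

/-- The state sum over the colorings of the short arcs by `Y`, twisted by `T`. -/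
def stateSum [Fintype Y] (D : Diagram) (A : Rˣ) (T : Equiv.Perm Y) : R :=
  ∑ col : D.ShortArc → Y, ∏ c, D.weightAt A T col c

/-- After recoloring by `T ^ f e`, the jump of `f` at a crossing matches the twist in its weight.
All four half-edges are then shifted by the same power of `T`, which `planarWeight` does not see. -/
theorem IsAlexanderNumbering.stateSum_eq [Fintype Y] {D : Diagram} {f : D.ShortArc → ℤ}
    (hf : D.IsAlexanderNumbering f) (A : Rˣ) (T : Equiv.Perm Y) :
    D.stateSum A T = D.stateSum A (1 : Equiv.Perm Y) := by
  let E : (D.ShortArc → Y) ≃ (D.ShortArc → Y) := Equiv.piCongrRight fun e => T ^ f e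
  rw [stateSum, ← Equiv.sum_comp E]
  refine Finset.sum_congr rfl fun col _ => Finset.prod_congr rfl fun c _ => ?_
  obtain ⟨h₁, h₂, h₃⟩ := hf c
  simp only [E, weightAt, crossingWeight, Equiv.piCongrRight_apply, Pi.map_apply,
    ← Equiv.Perm.mul_apply, ← zpow_add, ← h₁, ← h₂, one_zpow, Equiv.Perm.one_apply,
    add_comm (D.sign c : ℤ), ← h₃, planarWeight_map]

section Relabel

variable {D D' : Diagram} [Fintype Y]

/-- Renaming the crossings and moving their endpoints along the circles by a permutation `τ`. -/
theorem stateSum_relabel (φ : D.Crossing ≃ D'.Crossing) (hs : ∀ c, D'.sign (φ c) = D.sign c)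
    (hfree : D.free = D'.free) (τ : Equiv.Perm D.Endpoint)
    (hτ : ∀ v, D'.next (Prod.map φ id v) = Prod.map φ id (τ (D.next (τ.symm v))))
    (A : Rˣ) (T : Equiv.Perm Y) :
    D'.stateSum A T = ∑ col : D.ShortArc → Y, ∏ c, crossingWeight A T (D.sign c)
      (col (D.inArc (τ.symm (c, .over)))) (col (D.inArc (τ.symm (c, .under))))
      (col (D.outArc (τ.symm (c, .over)))) (col (D.outArc (τ.symm (c, .under)))) := by
  let ψ : D.Endpoint ≃ D'.Endpoint := τ.trans (φ.prodCongr (Equiv.refl _))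
  let e : D.ShortArc ≃ D'.ShortArc := Equiv.sumCongr ψ (finCongr hfree)
  have hout (c t) : D'.outArc (φ c, t) = e (D.outArc (τ.symm (c, t))) := by
    simp [e, ψ, outArc]
  have hin (c t) : D'.inArc (φ c, t) = e (D.inArc (τ.symm (c, t))) := by
    have : D'.next.symm (φ c, t) = ψ (D.next.symm (τ.symm (c, t))) := by
      rw [Equiv.symm_apply_eq]
      have := hτ (τ (D.next.symm (τ.symm (c, t))))
      simp only [Equiv.symm_apply_apply, Equiv.apply_symm_apply] at this
      exact this.symm
    simp only [inArc, this, e, Equiv.sumCongr_apply, Sum.map_inl]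
  rw [stateSum, ← Equiv.sum_comp (e.arrowCongr (Equiv.refl Y))]
  refine Finset.sum_congr rfl fun col _ => ?_
  rw [← Equiv.prod_comp φ]
  refine Finset.prod_congr rfl fun c _ => ?_
  simp only [weightAt, hs, hin, hout, Equiv.arrowCongr_apply, Function.comp_apply,
    Equiv.symm_apply_apply, Equiv.refl_apply]

theorem Iso.stateSum_eq (h : D.Iso D') (A : Rˣ) (T : Equiv.Perm Y) :
    D.stateSum A T = D'.stateSum A T := by
  obtain ⟨φ, hs, hn, hfree⟩ := h
  rw [stateSum_relabel φ hs hfree 1 hn]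
  rfl

end Relabel

/-! ### Erasing crossings -/

section Erasure

variable {D D' : Diagram} [Fintype Y]

/-- The indicators select the colorings that are constant through the erased endpoints, and these
are exactly the pullbacks along `π` of colorings of `D`. -/
theorem IsErasure.sum_eq {P : Finset D'.Crossing} (h : D'.IsErasure D P) (A : Rˣ)
    (T : Equiv.Perm Y) :
    ∑ col : D'.ShortArc → Y,
      (∏ c ∈ P, ∏ t, if col (D'.inArc (c, t)) = col (D'.outArc (c, t)) then (1 : R) else 0) *
        ∏ c ∈ Pᶜ, D'.weightAt A T col c = D.stateSum A T := by
  obtain ⟨ι, π, hι, hrange, hs, hπ, hin, hout, hker⟩ := h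
  have himage : Finset.univ.image ι = Pᶜ := by
    apply Finset.coe_injective
    simpa using hrange
  have hcompat (col : D.ShortArc → Y) (c) (hc : c ∈ P) (t) :
      π (D'.inArc (c, t)) = π (D'.outArc (c, t)) :=
    (hker _ _).2 (.rel _ _ ⟨(c, t), hc, rfl, rfl⟩)
  symm
  refine Finset.sum_of_injOn (fun col => col ∘ π) (fun a _ b _ hab => hπ.injective_comp_right hab)
    (fun _ _ => Finset.mem_coe.2 (Finset.mem_univ _)) ?_ ?_
  · intro col _ hcol
    have hex : ∃ c ∈ P, ∃ t, col (D'.inArc (c, t)) ≠ col (D'.outArc (c, t)) := by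
      by_contra! hall
      have hconst (e e') (he : π e = π e') : col e = col e' := by
        rw [hker] at he
        induction he with
        | rel a b hab =>
          obtain ⟨x, hx, rfl, rfl⟩ := hab
          exact hall x.1 hx x.2
        | refl => rfl
        | symm _ _ _ ih => exact ih.symm
        | trans _ _ _ _ _ ih₁ ih₂ => exact ih₁.trans ih₂
      exact hcol ⟨col ∘ Function.surjInv hπ, by simp, funext fun e =>
        hconst _ _ (Function.surjInv_eq hπ _)⟩
    obtain ⟨c, hc, t, ht⟩ := hex
    rw [Finset.prod_eq_zero hc (Finset.prod_eq_zero (Finset.mem_univ t) (if_neg ht)), zero_mul]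
  · intro col _
    rw [Finset.prod_eq_one (s := P), one_mul, ← himage, Finset.prod_image hι.injOn]
    · refine Finset.prod_congr rfl fun c _ => ?_
      simp only [weightAt, Function.comp_apply, hin, hout, hs]
    · intro c hc
      refine Finset.prod_eq_one fun t _ => if_pos ?_
      simp only [Function.comp_apply, hcompat col c hc t]

end Erasure

/-! ### Arcs between adjacent endpoints -/

section Adjacent

variable {D : Diagram}

/-- The short arc before an endpoint, with respect to a direction of travel. -/
def arcBefore (D : Diagram) (δ : ℤˣ) (p : D.Endpoint) : D.ShortArc :=
  if δ = 1 then D.inArc p else D.outArc p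

/-- The short arc after an endpoint, with respect to a direction of travel. -/
def arcAfter (D : Diagram) (δ : ℤˣ) (p : D.Endpoint) : D.ShortArc :=
  if δ = 1 then D.outArc p else D.inArc p

theorem outArc_injective : Function.Injective D.outArc := fun _ _ h => Sum.inl_injective h

theorem inArc_injective : Function.Injective D.inArc :=
  fun _ _ h => D.next.symm.injective (Sum.inl_injective h)

theorem inArc_next (p : D.Endpoint) : D.inArc (D.next p) = D.outArc p := by
  simp [inArc, outArc]

theorem Adjacent.arcAfter_eq {δ : ℤˣ} {p q : D.Endpoint} (h : D.Adjacent δ p q) :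
    D.arcBefore δ q = D.arcAfter δ p := by
  obtain ⟨rfl, rfl⟩ | ⟨rfl, rfl⟩ := h
  · simp [arcBefore, arcAfter, inArc_next]
  · simp [arcBefore, arcAfter, inArc_next, show (-1 : ℤˣ) ≠ 1 by decide]

theorem Adjacent.inArc_ne {δ : ℤˣ} {p q r : D.Endpoint} (h : D.Adjacent δ p q) (hp : r ≠ p)
    (hq : r ≠ q) : D.inArc r ≠ D.arcAfter δ p := by
  obtain ⟨rfl, rfl⟩ | ⟨rfl, rfl⟩ := h
  · simpa [arcAfter, ← inArc_next, inArc_injective.eq_iff] using hq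
  · simpa [arcAfter, inArc_injective.eq_iff, show (-1 : ℤˣ) ≠ 1 by decide] using hp

theorem Adjacent.outArc_ne {δ : ℤˣ} {p q r : D.Endpoint} (h : D.Adjacent δ p q) (hp : r ≠ p)
    (hq : r ≠ q) : D.outArc r ≠ D.arcAfter δ p := by
  obtain ⟨rfl, rfl⟩ | ⟨rfl, rfl⟩ := h
  · simpa [arcAfter, outArc_injective.eq_iff] using hp
  · simpa [arcAfter, inArc_next, outArc_injective.eq_iff, show (-1 : ℤˣ) ≠ 1 by decide] using hq

theorem Adjacent.arcBefore_ne_of_ne {δ δ' : ℤˣ} {p q r : D.Endpoint} (h : D.Adjacent δ p q)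
    (hp : r ≠ p) (hq : r ≠ q) : D.arcBefore δ' r ≠ D.arcAfter δ p := by
  change (if δ' = 1 then D.inArc r else D.outArc r) ≠ _
  split_ifs
  exacts [h.inArc_ne hp hq, h.outArc_ne hp hq]

theorem Adjacent.arcAfter_ne_of_ne {δ δ' : ℤˣ} {p q r : D.Endpoint} (h : D.Adjacent δ p q)
    (hp : r ≠ p) (hq : r ≠ q) : D.arcAfter δ' r ≠ D.arcAfter δ p := by
  change (if δ' = 1 then D.outArc r else D.inArc r) ≠ _
  split_ifs
  exacts [h.outArc_ne hp hq, h.inArc_ne hp hq]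

theorem Adjacent.arcBefore_ne {δ : ℤˣ} {p q : D.Endpoint} (h : D.Adjacent δ p q) (hpq : p ≠ q) :
    D.arcBefore δ p ≠ D.arcAfter δ p := by
  obtain ⟨rfl, rfl⟩ | ⟨rfl, rfl⟩ := h
  · simpa [arcBefore, arcAfter, ← inArc_next, inArc_injective.eq_iff] using hpq
  · simpa [arcBefore, arcAfter, inArc_next, outArc_injective.eq_iff, show (-1 : ℤˣ) ≠ 1 by decide]
      using hpq

theorem Adjacent.arcAfter_ne {δ : ℤˣ} {p q : D.Endpoint} (h : D.Adjacent δ p q) (hpq : p ≠ q) :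
    D.arcAfter δ q ≠ D.arcAfter δ p := by
  obtain ⟨rfl, rfl⟩ | ⟨rfl, rfl⟩ := h
  · simpa [arcAfter, outArc_injective.eq_iff] using hpq.symm
  · simpa [arcAfter, inArc_injective.eq_iff, show (-1 : ℤˣ) ≠ 1 by decide] using hpq.symm

theorem crossingWeight_eq_directedWeight (A : Rˣ) (T : Equiv.Perm Y) (ε x y : ℤˣ)
    (col : D.ShortArc → Y) (p q : D.Endpoint) :
    crossingWeight A T ε (col (D.inArc p)) (col (D.inArc q)) (col (D.outArc p)) (col (D.outArc q)) =
      directedWeight A T x y ε (col (D.arcBefore x p)) (col (D.arcAfter x p))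
        (col (D.arcBefore y q)) (col (D.arcAfter y q)) := by
  unfold directedWeight arcBefore arcAfter
  split_ifs <;> rfl

theorem Adjacent.prod_weightAt_update {δ : ℤˣ} {p q : D.Endpoint} (h : D.Adjacent δ p q)
    {P : Finset D.Crossing} (hp : p.1 ∈ P) (hq : q.1 ∈ P) (A : Rˣ) (T : Equiv.Perm Y)
    (col : D.ShortArc → Y) (y : Y) :
    ∏ c ∈ Pᶜ, D.weightAt A T (Function.update col (D.arcAfter δ p) y) c =
      ∏ c ∈ Pᶜ, D.weightAt A T col c := by
  refine Finset.prod_congr rfl fun c hc => ?_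
  have hcp (t) : (c, t) ≠ p := by rintro rfl; exact Finset.mem_compl.1 hc hp
  have hcq (t) : (c, t) ≠ q := by rintro rfl; exact Finset.mem_compl.1 hc hq
  simp only [weightAt, Function.update_of_ne (h.inArc_ne (hcp _) (hcq _)),
    Function.update_of_ne (h.outArc_ne (hcp _) (hcq _))]

end Adjacent

theorem prod_strand {M : Type*} [CommMonoid M] (f : Strand → M) :
    ∏ t, f t = f .over * f .under := by
  rw [show (Finset.univ : Finset Strand) = {.over, .under} from rfl, Finset.prod_pair (by decide)]

/-! ### Behavior of the state sum under Reidemeister moves -/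

section Moves

variable {D D' : Diagram} [Fintype Y] [Nonempty Y] [CharZero R] {A : Rˣ}

theorem Move1.stateSum_eq (h : D'.Move1 D)
    (hY : (Fintype.card Y : R) = -(A : R) ^ 2 - ((A⁻¹ : Rˣ) : R) ^ 2) :
    ∃ u : R, u ≠ 0 ∧ ∀ T : Equiv.Perm Y, D'.stateSum A T = u * D.stateSum A T := by
  obtain ⟨c, t, hnext, hE⟩ := h
  rw [← Finset.coe_singleton] at hE
  -- The kink factor depends on the sign of the crossing but not on `T`. This is what lets the
  -- comparison of `T` with `1` survive the move.
  refine ⟨-((A ^ (D'.sign c : ℤ) : Rˣ) : R) ^ 3, neg_ne_zero.2 (pow_ne_zero _ (Units.ne_zero _)),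
    fun T => ?_⟩
  have hadj : D'.Adjacent 1 (c, t) (c, t.flip) := .inl ⟨rfl, hnext⟩
  have ht : (c, t) ≠ (c, t.flip) := by cases t <;> simp [Strand.flip]
  have h₁ := hadj.arcBefore_ne ht
  have h₂ := hadj.arcAfter_ne ht
  have h₃ := hadj.arcAfter_eq
  rw [← hE.sum_eq, stateSum, Finset.mul_sum]
  simp only [← Finset.prod_mul_prod_compl {c}, ← mul_assoc]
  refine sum_mul_congr_update (D'.arcAfter 1 (c, t))
    (hadj.prod_weightAt_update (by simp) (by simp) A T) fun col => ?_
  cases t <;> simp only [Strand.flip, arcAfter, arcBefore, if_true] at h₁ h₂ h₃ ⊢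
  · simp [weightAt, prod_strand, h₁, h₂, h₃, sum_crossingWeight_kink_over T hY, eq_comm]
  · simp [weightAt, prod_strand, h₁, h₂, h₃, sum_crossingWeight_kink_under T hY, eq_comm]

theorem Move2.stateSum_eq (h : D'.Move2 D)
    (hY : (Fintype.card Y : R) = -(A : R) ^ 2 - ((A⁻¹ : Rˣ) : R) ^ 2) (T : Equiv.Perm Y) :
    D'.stateSum A T = D.stateSum A T := by
  obtain ⟨c, d, hcd, hsign, hover, hunder, hE⟩ := h
  rw [← Finset.coe_pair] at hE
  have hsign : D'.sign d = -D'.sign c := by rw [hsign, neg_neg]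
  obtain ⟨δ, hadj'⟩ : ∃ δ, D'.Adjacent δ (c, .under) (d, .under) := by
    rcases hunder with h | h
    exacts [⟨1, .inl ⟨rfl, h⟩⟩, ⟨-1, .inr ⟨rfl, h⟩⟩]
  have hadj : D'.Adjacent 1 (c, .over) (d, .over) := .inl ⟨rfl, hover⟩
  have ht : (c, Strand.over) ≠ (d, Strand.over) := by simp [hcd]
  have ht' : (c, Strand.under) ≠ (d, Strand.under) := by simp [hcd]
  have h₁ := hadj.arcBefore_ne ht
  have h₂ := hadj.arcAfter_ne ht
  have h₃ := hadj.arcAfter_eq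
  have h₄ := hadj'.arcBefore_ne ht'
  have h₅ := hadj'.arcAfter_ne ht'
  have h₆ := hadj'.arcAfter_eq
  have h₇ (v) : D'.inArc (v, .over) ≠ D'.arcAfter δ (c, .under) :=
    hadj'.inArc_ne (by simp) (by simp)
  have h₈ (v) : D'.outArc (v, .over) ≠ D'.arcAfter δ (c, .under) :=
    hadj'.outArc_ne (by simp) (by simp)
  have h₉ (v) : D'.inArc (v, .under) ≠ D'.arcAfter 1 (c, .over) :=
    hadj.inArc_ne (by simp) (by simp)
  have h₁₀ (v) : D'.outArc (v, .under) ≠ D'.arcAfter 1 (c, .over) :=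
    hadj.outArc_ne (by simp) (by simp)
  rw [← hE.sum_eq, stateSum]
  simp only [← Finset.prod_mul_prod_compl {c, d}]
  refine sum_mul_congr_update_two _ _ (hadj.prod_weightAt_update (by simp) (by simp) A T)
    (hadj'.prod_weightAt_update (by simp) (by simp) A T) fun col => ?_
  obtain rfl | rfl := Int.units_eq_one_or δ
  · simp only [arcAfter, arcBefore, if_true] at h₁ h₂ h₃ h₄ h₅ h₆ h₇ h₈ h₉ h₁₀ ⊢
    simp [Finset.prod_pair hcd, weightAt, prod_strand, h₁, h₂, h₃, h₄, h₅, h₆, h₇, h₈, h₉, h₁₀,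
      hsign, sum_crossingWeight_bigon T hY]
  · simp only [arcAfter, arcBefore, if_true, show (-1 : ℤˣ) ≠ 1 by decide, if_false]
      at h₁ h₂ h₃ h₄ h₅ h₆ h₇ h₈ h₉ h₁₀ ⊢
    simp [Finset.prod_pair hcd, weightAt, prod_strand, h₁, h₂, h₃, h₄, h₅, h₆, h₇, h₈, h₉, h₁₀,
      hsign, sum_crossingWeight_bigon_antiparallel T hY]

theorem Move3.stateSum_eq (h : D.Move3 D')
    (hY : (Fintype.card Y : R) = -(A : R) ^ 2 - ((A⁻¹ : Rˣ) : R) ^ 2) (T : Equiv.Perm Y) :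
    D.stateSum A T = D'.stateSum A T := by
  obtain ⟨a, b, c, x, y, z, hab, hac, hbc, hx, hy, hz, h₁, h₂, φ, hs, hfree, hφ⟩ := h
  dsimp only at hφ
  generalize hτ : Equiv.swap (a, Strand.over) (b, Strand.over) *
    Equiv.swap (a, Strand.under) (c, Strand.over) *
    Equiv.swap (b, Strand.under) (c, Strand.under) = τ at hφ
  have hao : τ.symm (a, .over) = (b, .over) := by
    simp [← hτ, Equiv.symm_apply_eq, Equiv.swap_apply_def, hbc]
  have hau : τ.symm (a, .under) = (c, .over) := by
    simp [← hτ, Equiv.symm_apply_eq, Equiv.swap_apply_def]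
  have hbo : τ.symm (b, .over) = (a, .over) := by
    simp [← hτ, Equiv.symm_apply_eq, Equiv.swap_apply_def, hac]
  have hbu : τ.symm (b, .under) = (c, .under) := by
    simp [← hτ, Equiv.symm_apply_eq, Equiv.swap_apply_def, hab.symm]
  have hco : τ.symm (c, .over) = (a, .under) := by
    simp [← hτ, Equiv.symm_apply_eq, Equiv.swap_apply_def, hab, hac, hac.symm, hbc.symm]
  have hcu : τ.symm (c, .under) = (b, .under) := by
    simp [← hτ, Equiv.symm_apply_eq, Equiv.swap_apply_def, hac.symm]
  have hv (v t) (hva : v ≠ a) (hvb : v ≠ b) (hvc : v ≠ c) : τ.symm (v, t) = (v, t) := by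
    simp [← hτ, Equiv.symm_apply_eq, Equiv.swap_apply_def, hva, hvb, hvc]
  clear hτ
  have hx₁ := hx.arcBefore_ne (by simp [hab])
  have hx₂ := hx.arcAfter_ne (by simp [hab])
  have hy₁ := hy.arcBefore_ne (by simp)
  have hy₂ := hy.arcAfter_ne (by simp)
  have hz₁ := hz.arcBefore_ne (by simp [hbc])
  have hz₂ := hz.arcAfter_ne (by simp [hbc])
  have hxf : D.arcBefore x (a, .over) ≠ D.arcAfter y (a, .under) :=
    hy.arcBefore_ne_of_ne (by simp) (by simp [hac])
  have hxf' : D.arcAfter x (b, .over) ≠ D.arcAfter y (a, .under) :=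
    hy.arcAfter_ne_of_ne (by simp) (by simp [hbc])
  have hxg : D.arcBefore x (a, .over) ≠ D.arcAfter z (b, .under) :=
    hz.arcBefore_ne_of_ne (by simp) (by simp)
  have hxg' : D.arcAfter x (b, .over) ≠ D.arcAfter z (b, .under) :=
    hz.arcAfter_ne_of_ne (by simp) (by simp)
  have hye : D.arcBefore y (a, .under) ≠ D.arcAfter x (a, .over) :=
    hx.arcBefore_ne_of_ne (by simp) (by simp)
  have hye' : D.arcAfter y (c, .over) ≠ D.arcAfter x (a, .over) :=
    hx.arcAfter_ne_of_ne (by simp [hac.symm]) (by simp [hbc.symm])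
  have hyg : D.arcBefore y (a, .under) ≠ D.arcAfter z (b, .under) :=
    hz.arcBefore_ne_of_ne (by simp [hab]) (by simp [hac])
  have hyg' : D.arcAfter y (c, .over) ≠ D.arcAfter z (b, .under) :=
    hz.arcAfter_ne_of_ne (by simp) (by simp)
  have hze : D.arcBefore z (b, .under) ≠ D.arcAfter x (a, .over) :=
    hx.arcBefore_ne_of_ne (by simp) (by simp)
  have hze' : D.arcAfter z (c, .under) ≠ D.arcAfter x (a, .over) :=
    hx.arcAfter_ne_of_ne (by simp) (by simp)
  have hzf : D.arcBefore z (b, .under) ≠ D.arcAfter y (a, .under) :=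
    hy.arcBefore_ne_of_ne (by simp [hab.symm]) (by simp)
  have hzf' : D.arcAfter z (c, .under) ≠ D.arcAfter y (a, .under) :=
    hy.arcAfter_ne_of_ne (by simp [hac.symm]) (by simp)
  have hef : D.arcAfter x (a, .over) ≠ D.arcAfter y (a, .under) :=
    hy.arcAfter_ne_of_ne (by simp) (by simp [hac])
  have heg : D.arcAfter x (a, .over) ≠ D.arcAfter z (b, .under) :=
    hz.arcAfter_ne_of_ne (by simp) (by simp)
  have hfg : D.arcAfter y (a, .under) ≠ D.arcAfter z (b, .under) :=
    hz.arcAfter_ne_of_ne (by simp [hab]) (by simp [hac])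
  have hP (f : D.Crossing → R) : ∏ v, f v = (f a * f b * f c) * ∏ v ∈ {a, b, c}ᶜ, f v := by
    rw [← Finset.prod_mul_prod_compl {a, b, c}, Finset.prod_insert (by simp [hab, hac]),
      Finset.prod_pair hbc, ← mul_assoc (f a)]
  have hrest (col : D.ShortArc → Y) : ∏ v ∈ {a, b, c}ᶜ, crossingWeight A T (D.sign v)
      (col (D.inArc (τ.symm (v, .over)))) (col (D.inArc (τ.symm (v, .under))))
      (col (D.outArc (τ.symm (v, .over)))) (col (D.outArc (τ.symm (v, .under)))) =
      ∏ v ∈ {a, b, c}ᶜ, D.weightAt A T col v := by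
    refine Finset.prod_congr rfl fun v hv' => ?_
    simp only [Finset.mem_compl, Finset.mem_insert, Finset.mem_singleton, not_or] at hv'
    simp only [weightAt, hv v _ hv'.1 hv'.2.1 hv'.2.2]
  rw [stateSum_relabel φ hs hfree _ hφ, stateSum]
  simp only [hP, hrest, hao, hau, hbo, hbu, hco, hcu]
  refine sum_mul_congr_update_three (D.arcAfter x (a, .over)) (D.arcAfter y (a, .under))
    (D.arcAfter z (b, .under)) (r := fun col => ∏ v ∈ {a, b, c}ᶜ, D.weightAt A T col v)
    (hx.prod_weightAt_update (by simp) (by simp) A T)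
    (hy.prod_weightAt_update (by simp) (by simp) A T)
    (hz.prod_weightAt_update (by simp) (by simp) A T) fun col => ?_
  simp only [weightAt, crossingWeight_eq_directedWeight A T (D.sign a) x y,
    crossingWeight_eq_directedWeight A T (D.sign b) x z,
    crossingWeight_eq_directedWeight A T (D.sign c) y z, hx.arcAfter_eq, hy.arcAfter_eq,
    hz.arcAfter_eq]
  simp only [Function.update_self, Function.update_of_ne, ne_eq, not_false_eq_true, hx₁, hx₂, hy₁,
    hy₂, hz₁, hz₂, hxf, hxf', hxg, hxg', hye, hye', hyg, hyg', hze, hze', hzf, hzf', hef, heg, hfg]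
  exact sum_directedWeight_triangle T hY h₁ h₂ _ _ _ _ _ _

theorem Move.stateSum_eq (h : D.Move D')
    (hY : (Fintype.card Y : R) = -(A : R) ^ 2 - ((A⁻¹ : Rˣ) : R) ^ 2) :
    ∃ u : R, u ≠ 0 ∧ ∀ T : Equiv.Perm Y, D.stateSum A T = u * D'.stateSum A T := by
  rcases h with h | h | h | h
  · exact ⟨1, one_ne_zero, fun T => by rw [one_mul, h.stateSum_eq]⟩
  · exact h.stateSum_eq hY
  · exact ⟨1, one_ne_zero, fun T => by rw [one_mul, h.stateSum_eq hY]⟩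
  · exact ⟨1, one_ne_zero, fun T => by rw [one_mul, h.stateSum_eq hY]⟩

theorem AlmostClassical.stateSum_eq (h : D.AlmostClassical)
    (hY : (Fintype.card Y : R) = -(A : R) ^ 2 - ((A⁻¹ : Rˣ) : R) ^ 2) (T : Equiv.Perm Y) :
    D.stateSum A T = D.stateSum A (1 : Equiv.Perm Y) := by
  obtain ⟨D₀, hD, f, hf⟩ := h
  suffices D.stateSum A T = D.stateSum A (1 : Equiv.Perm Y) ↔
      D₀.stateSum A T = D₀.stateSum A (1 : Equiv.Perm Y) from this.2 (hf.stateSum_eq A T)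
  clear hf f
  induction hD with
  | rel D D' h =>
    obtain ⟨u, hu, h⟩ := h.stateSum_eq hY
    rw [h, h, mul_right_inj' hu]
  | refl => rfl
  | symm _ _ _ ih => exact ih.symm
  | trans _ _ _ _ _ ih₁ ih₂ => exact ih₁.trans ih₂

end Moves

end StateSum
end Diagram

/-! ### Pole words and their alternating sums -/

section ReducedLength

/-- The weight of a pole. -/
def Side.weight : Side → ℤ
  | .left => -1
  | .right => 1

/-- The alternating sum of the weights of the poles in a word. -/
def alternatingSum : List Side → ℤ
  | [] => 0
  | σ :: w => σ.weight - alternatingSum w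

theorem alternatingSum_append (w w' : List Side) :
    alternatingSum (w ++ w') = alternatingSum w + (-1) ^ w.length * alternatingSum w' := by
  induction w with
  | nil => simp [alternatingSum]
  | cons σ w ih => simp only [List.cons_append, alternatingSum, ih, List.length_cons, pow_succ]; ring

/-- In a word of even length, rotation by one letter reverses all the alternating signs. -/
theorem abs_alternatingSum_of_isRotated {w w' : List Side} (h : w ~r w') (hw : Even w.length) :
    |alternatingSum w| = |alternatingSum w'| := by
  obtain ⟨n, rfl⟩ := h
  induction n generalizing w with
  | zero => simp
  | succ n ih =>
    cases w with
    | nil => simp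
    | cons σ w =>
      rw [List.rotate_cons_succ, ← ih (by simpa using hw), alternatingSum_append, alternatingSum]
      have : Odd w.length := by simpa [Nat.even_add_one] using hw
      rw [this.neg_one_pow, ← abs_neg]
      simp only [alternatingSum]
      congr 1
      ring

theorem CancelStep.length_eq {w w' : List Side} (h : CancelStep w w') :
    w.length = w'.length + 2 := by
  obtain ⟨σ, h⟩ := h
  simpa using h.perm.length_eq

theorem CancelStep.abs_alternatingSum {w w' : List Side} (h : CancelStep w w')
    (hw : Even w.length) : |alternatingSum w| = |alternatingSum w'| := by
  obtain ⟨σ, h⟩ := h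
  rw [abs_alternatingSum_of_isRotated h hw]
  simp [alternatingSum]

theorem alternatingSum_of_isChain {w : List Side} (hw : w.IsChain (· ≠ ·)) :
    |alternatingSum w| = w.length := by
  suffices ∀ σ w, (σ :: w).IsChain (· ≠ ·) →
      alternatingSum (σ :: w) = σ.weight * (w.length + 1 : ℤ) by
    cases w with
    | nil => simp [alternatingSum]
    | cons σ w =>
      have hpos : (0 : ℤ) ≤ w.length + 1 := by positivity
      rw [this σ w hw, abs_mul, abs_of_nonneg hpos]
      cases σ <;> simp [Side.weight]
  intro σ w
  induction w generalizing σ with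
  | nil => simp [alternatingSum]
  | cons ρ w ih =>
    intro h
    rw [List.isChain_cons_cons] at h
    rw [alternatingSum, ih ρ h.2, List.length_cons]
    cases σ <;> cases ρ <;> simp [Side.weight] at h ⊢ <;> ring

theorem abs_alternatingSum_of_irreducible {w : List Side} (h : ∀ w', ¬ CancelStep w w') :
    |alternatingSum w| = w.length := by
  refine alternatingSum_of_isChain (List.isChain_iff_forall_rel_of_append_cons_cons.2 ?_)
  rintro a b l₁ l₂ rfl rfl
  exact h (l₂ ++ l₁) ⟨a, List.isRotated_append⟩

theorem exists_irreducible (w : List Side) :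
    ∃ w', Relation.ReflTransGen CancelStep w w' ∧ ∀ w'', ¬ CancelStep w' w'' := by
  induction hn : w.length using Nat.strong_induction_on generalizing w with
  | _ n ih =>
    by_cases h : ∃ w', CancelStep w w'
    · obtain ⟨w', h⟩ := h
      obtain ⟨v, hv, hv'⟩ := ih w'.length (by have := h.length_eq; omega) w' rfl
      exact ⟨v, .head h hv, hv'⟩
    · exact ⟨w, .refl, not_exists.1 h⟩

/-- Cancellation preserves the absolute alternating sum, and an irreducible word alternates between
the sides, so there the sum has the length as its absolute value. In particular the reduced length
does not depend on the cancellations chosen. -/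
theorem reducedLength_eq {w : List Side} (hw : Even w.length) :
    (reducedLength w : ℤ) = |alternatingSum w| := by
  have key {w' : List Side} (h : Relation.ReflTransGen CancelStep w w') :
      Even w'.length ∧ |alternatingSum w'| = |alternatingSum w| := by
    induction h with
    | refl => exact ⟨hw, rfl⟩
    | tail _ h ih =>
      refine ⟨?_, (h.abs_alternatingSum ih.1).symm.trans ih.2⟩
      have := h.length_eq ▸ ih.1
      simpa [Nat.even_add] using this
  have hset : {n | ∃ w', Relation.ReflTransGen CancelStep w w' ∧ (∀ w'', ¬ CancelStep w' w'') ∧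
      w'.length = n} = {(alternatingSum w).natAbs} := by
    obtain ⟨v, hv, hv'⟩ := exists_irreducible w
    have aux {w' : List Side} (h : Relation.ReflTransGen CancelStep w w')
        (h' : ∀ w'', ¬ CancelStep w' w'') : w'.length = (alternatingSum w).natAbs := by
      zify
      rw [← (key h).2, abs_alternatingSum_of_irreducible h']
    ext n
    constructor
    · rintro ⟨w', h, h', rfl⟩
      exact aux h h'
    · rintro rfl
      exact ⟨v, hv, hv', aux hv hv'⟩
  rw [reducedLength, hset, csInf_singleton, Int.natCast_natAbs]

theorem even_alternatingSum {w : List Side} (hw : Even w.length) : Even (alternatingSum w) := by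
  suffices Even (alternatingSum w + w.length) by
    rw [Int.even_add] at this
    exact this.2 (by exact_mod_cast hw)
  clear hw
  induction w with
  | nil => simp [alternatingSum]
  | cons σ w ih =>
    obtain ⟨k, hk⟩ := ih
    cases σ
    · exact ⟨w.length - k, by simp [alternatingSum, Side.weight]; linarith⟩
    · exact ⟨w.length - k + 1, by simp [alternatingSum, Side.weight]; linarith⟩

end ReducedLength

namespace Diagram

/-! ### Walking along state curves -/

section Walk

variable (D : Diagram) (s : D.State)

theorem otherEnd_otherEnd (h : D.HalfEdge) : D.otherEnd (D.otherEnd h) = h := by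
  obtain ⟨c, t, d⟩ := h
  cases d <;> simp [otherEnd]

theorem otherEnd_ne (h : D.HalfEdge) : D.otherEnd h ≠ h := by
  obtain ⟨c, t, d⟩ := h
  cases d <;> simp [otherEnd]

theorem smooth_smooth (h : D.HalfEdge) : D.smooth s (D.smooth s h) = h := by
  obtain ⟨c, t, d⟩ := h
  by_cases hc : D.IsOriented s c <;> cases t <;> cases d <;>
    simp [smooth, hc, Strand.flip, Dir.flip]

theorem smooth_ne (h : D.HalfEdge) : D.smooth s h ≠ h := by
  obtain ⟨c, t, d⟩ := h
  by_cases hc : D.IsOriented s c <;> cases t <;> simp [smooth, hc, Strand.flip]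

theorem arcOf_eq_iff (h h' : D.HalfEdge) :
    D.arcOf h = D.arcOf h' ↔ h' = h ∨ h' = D.otherEnd h := by
  obtain ⟨c, t, d⟩ := h
  obtain ⟨c', t', d'⟩ := h'
  cases d <;> cases d' <;> simp [arcOf, otherEnd, inArc, outArc]
  · rw [eq_comm, eq_comm (a := t)]
  · rw [Prod.ext_iff, eq_comm, eq_comm (b := t')]
  · rw [Equiv.eq_symm_apply, eq_comm, Prod.ext_iff]
  · rw [eq_comm, eq_comm (a := t)]

/-- Passing to the other end of a short arc. -/
def otherEndPerm : Equiv.Perm D.HalfEdge :=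
  Function.Involutive.toPerm D.otherEnd D.otherEnd_otherEnd

/-- Passing through a smoothing. -/
def smoothPerm : Equiv.Perm D.HalfEdge :=
  Function.Involutive.toPerm (D.smooth s) (D.smooth_smooth s)

/-- Travelling along the state curves, as a permutation. -/
def walkPerm : Equiv.Perm D.HalfEdge := D.smoothPerm s * D.otherEndPerm

/-- The walk is a product of two involutions, so conjugation by one of them inverts it, as in a
dihedral group. -/
theorem otherEndPerm_mul_walkPerm_zpow (k : ℤ) :
    D.otherEndPerm * D.walkPerm s ^ k = D.walkPerm s ^ (-k) * D.otherEndPerm := by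
  have h₁ : D.otherEndPerm * D.otherEndPerm = 1 := Equiv.ext D.otherEnd_otherEnd
  have h₂ : D.smoothPerm s * D.smoothPerm s = 1 := Equiv.ext (D.smooth_smooth s)
  have h₃ : D.otherEndPerm * D.walkPerm s * D.otherEndPerm⁻¹ = (D.walkPerm s)⁻¹ := by
    rw [walkPerm, mul_inv_rev, inv_eq_of_mul_eq_one_left h₁, inv_eq_of_mul_eq_one_left h₂,
      mul_assoc, mul_assoc, h₁, mul_one]
  rw [zpow_neg, ← inv_zpow, ← h₃, conj_zpow, inv_mul_cancel_right]

theorem otherEnd_walkPerm_zpow (k : ℤ) (h : D.HalfEdge) :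
    D.otherEnd ((D.walkPerm s ^ k) h) = (D.walkPerm s ^ (-k)) (D.otherEnd h) :=
  congrArg (· h) (congrArg DFunLike.coe (D.otherEndPerm_mul_walkPerm_zpow s k))

/-- A state curve never traverses a short arc in both directions. -/
theorem walkPerm_zpow_ne_otherEnd (k : ℤ) (h : D.HalfEdge) :
    (D.walkPerm s ^ k) h ≠ D.otherEnd h := by
  intro hk
  -- Halfway along such a walk there would be a fixed point of `otherEnd` (even length) or of
  -- `smooth` (odd length), and neither has one.
  obtain ⟨m, rfl | rfl⟩ := Int.even_or_odd' k
  · apply D.otherEnd_ne ((D.walkPerm s ^ m) h)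
    rw [otherEnd_walkPerm_zpow, ← hk, ← Equiv.Perm.mul_apply, ← zpow_add]
    congr 2
    ring
  · apply D.smooth_ne s (D.otherEnd ((D.walkPerm s ^ m) h))
    change D.walkPerm s ((D.walkPerm s ^ m) h) = _
    rw [otherEnd_walkPerm_zpow, ← hk, ← Equiv.Perm.mul_apply, ← Equiv.Perm.mul_apply, ← zpow_add,
      ← zpow_one_add]
    congr 2
    ring

theorem walkPerm_zpow_eq_of_arcOf_eq {i j : ℤ} {h : D.HalfEdge}
    (hij : D.arcOf ((D.walkPerm s ^ i) h) = D.arcOf ((D.walkPerm s ^ j) h)) :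
    (D.walkPerm s ^ i) h = (D.walkPerm s ^ j) h := by
  rw [arcOf_eq_iff] at hij
  rcases hij with hij | hij
  · exact hij.symm
  · refine absurd ?_ (D.walkPerm_zpow_ne_otherEnd s (j - i) ((D.walkPerm s ^ i) h))
    rw [← hij, ← Equiv.Perm.mul_apply, ← zpow_add, sub_add_cancel]

end Walk

/-! ### Twist along a loop and its pole number -/

section Twist

variable (D : Diagram) (s : D.State)

/-- The sign of a direction. -/
def _root_.VirtualLink.Dir.sign : Dir → ℤ
  | .inc => -1
  | .out => 1

/-- The change of the would-be Alexander numbering at a smoothing. -/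
def twist (h : D.HalfEdge) : ℤ :=
  match D.pole s h with
  | none => 0
  | some σ => h.2.2.sign * σ.weight

/-- A disoriented smoothing joins half-edges of equal direction, and its pole changes side when the
strand is travelled backwards. -/
theorem twist_smooth (h : D.HalfEdge) : D.twist s (D.smooth s h) = -D.twist s h := by
  obtain ⟨c, t, d⟩ := h
  by_cases hc : D.IsOriented s c
  · simp [twist, smooth, pole, hc]
  · obtain hs | hs := Int.units_eq_one_or (D.sign c) <;> cases t <;> cases d <;>
      simp [twist, smooth, pole, hc, hs, Strand.flip, Side.weight, Dir.sign,
        show (-1 : ℤˣ) ≠ 1 by decide]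

/-- The total twist along a part of a state curve. -/
def totalTwist (h : D.HalfEdge) (n : ℕ) : ℤ :=
  ∑ i ∈ Finset.range n, D.twist s (D.otherEnd ((D.walk s)^[i] h))

theorem otherEnd_dir (h : D.HalfEdge) : (D.otherEnd h).2.2 = h.2.2.flip := by
  obtain ⟨c, t, d⟩ := h
  cases d <;> rfl

theorem smooth_dir (h : D.HalfEdge) :
    (D.smooth s h).2.2 = if D.pole s h = none then h.2.2.flip else h.2.2 := by
  obtain ⟨c, t, d⟩ := h
  by_cases hc : D.IsOriented s c
  · simp [smooth, pole, hc]
  · simp only [smooth, pole, hc, if_false]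
    split_ifs <;> simp_all

/-- The direction of travel relative to the orientation of the link reverses exactly at the poles,
so the signs in the twist alternate from pole to pole. The second claim forces an even number of
poles on a closed loop. -/
theorem totalTwist_eq (h : D.HalfEdge) (hd : h.2.2 = .out) (n : ℕ) :
    D.totalTwist s h n = -alternatingSum ((List.range n).filterMap
        fun i => D.pole s (D.otherEnd ((D.walk s)^[i] h))) ∧
      ((D.walk s)^[n] h).2.2.sign = (-1) ^ ((List.range n).filterMap
        fun i => D.pole s (D.otherEnd ((D.walk s)^[i] h))).length := by
  have hsing (f : ℕ → Option Side) (n : ℕ) : [n].filterMap f = (f n).toList := by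
    cases hf : f n <;> simp [hf]
  induction n with
  | zero => simp [totalTwist, alternatingSum, hd, Dir.sign]
  | succ n ih =>
    obtain ⟨ih₁, ih₂⟩ := ih
    rw [totalTwist, Finset.sum_range_succ, ← totalTwist, ih₁, List.range_succ,
      List.filterMap_append, alternatingSum_append, Function.iterate_succ_apply', List.length_append,
      pow_add, ← ih₂, hsing]
    generalize (D.walk s)^[n] h = k
    rw [walk, smooth_dir, otherEnd_dir]
    cases hp : D.pole s (D.otherEnd k) with
    | none =>
      obtain ⟨c, t, d⟩ := k
      cases d <;> simp [hp, twist, alternatingSum, Dir.flip, Dir.sign]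
    | some σ =>
      obtain ⟨c, t, d⟩ := k
      cases d <;> simp [hp, twist, alternatingSum, Dir.flip, Dir.sign, otherEnd_dir] <;> ring

theorem abs_totalTwist (x : D.Endpoint) :
    |D.totalTwist s (x.1, x.2, .out) (Function.minimalPeriod (D.walk s) (x.1, x.2, .out))| =
      2 * (reducedLength (D.poleWord s (x.1, x.2, .out)) / 2 : ℕ) := by
  obtain ⟨h₁, h₂⟩ := D.totalTwist_eq s (x.1, x.2, .out) rfl
    (Function.minimalPeriod (D.walk s) (x.1, x.2, .out))
  rw [Function.iterate_minimalPeriod] at h₂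
  have heven : Even (D.poleWord s (x.1, x.2, .out)).length := by
    by_contra hodd
    rw [Nat.not_even_iff_odd] at hodd
    rw [poleWord] at hodd
    rw [hodd.neg_one_pow] at h₂
    simp [Dir.sign] at h₂
  rw [h₁, abs_neg]
  change |alternatingSum (D.poleWord s (x.1, x.2, .out))| = _
  have h₃ := reducedLength_eq heven
  have h₄ := (even_abs.2 (even_alternatingSum heven))
  rw [← h₃] at h₄ ⊢
  rw [Int.even_coe_nat] at h₄
  obtain ⟨k, hk⟩ := h₄
  omega

end Twist
-- Transport of colors and its monodromy
section Transport

variable {Y : Type*} (D : Diagram) (s : D.State) (T : Equiv.Perm Y)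

/-- A coloring of the short arcs that is compatible with the smoothings of a state. -/
def IsCompatible (col : D.ShortArc → Y) : Prop :=
  ∀ h : D.HalfEdge, col (D.arcOf (D.smooth s h)) = (T ^ D.twist s h) (col (D.arcOf h))

/-- Travelling along the state curves while transporting a color. -/
def transport : Equiv.Perm (D.HalfEdge × Y) where
  toFun q := (D.walk s q.1, (T ^ D.twist s (D.otherEnd q.1)) q.2)
  invFun q := (D.otherEnd (D.smooth s q.1), (T ^ D.twist s q.1) q.2)
  left_inv q := by
    simp [walk, smooth_smooth, otherEnd_otherEnd, twist_smooth]
  right_inv q := by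
    simp [walk, smooth_smooth, otherEnd_otherEnd, twist_smooth]

theorem transport_zpow_fst (k : ℤ) (q : D.HalfEdge × Y) :
    ((D.transport s T ^ k) q).1 = (D.walkPerm s ^ k) q.1 := by
  have h₁ (q : D.HalfEdge × Y) : (D.transport s T q).1 = D.walkPerm s q.1 := rfl
  have h₂ (q : D.HalfEdge × Y) : ((D.transport s T)⁻¹ q).1 = (D.walkPerm s)⁻¹ q.1 := by
    rw [Equiv.Perm.eq_inv_iff_eq, ← h₁]
    exact congrArg Prod.fst (Equiv.apply_symm_apply _ _)
  induction k generalizing q with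
  | zero => rfl
  | succ n ih => rw [zpow_add_one, zpow_add_one, Equiv.Perm.mul_apply, ih, h₁, Equiv.Perm.mul_apply]
  | pred n ih => rw [zpow_sub_one, zpow_sub_one, Equiv.Perm.mul_apply, ih, h₂, Equiv.Perm.mul_apply]

theorem transport_pow (n : ℕ) (h : D.HalfEdge) (y : Y) :
    (D.transport s T ^ n) (h, y) = ((D.walk s)^[n] h, (T ^ D.totalTwist s h n) y) := by
  induction n with
  | zero => simp [totalTwist]
  | succ n ih =>
    rw [pow_succ', Equiv.Perm.mul_apply, ih, Function.iterate_succ_apply',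
      totalTwist.eq_1 _ _ _ (n + 1), Finset.sum_range_succ, ← totalTwist, add_comm, zpow_add, Equiv.Perm.mul_apply]
    rfl

variable {D s T}

theorem IsCompatible.transport_pow {col : D.ShortArc → Y} (hcol : D.IsCompatible s T col) (n : ℕ)
    (h : D.HalfEdge) : (D.transport s T ^ n) (h, col (D.arcOf h)) =
      ((D.walk s)^[n] h, col (D.arcOf ((D.walk s)^[n] h))) := by
  induction n with
  | zero => rfl
  | succ n ih =>
    rw [pow_succ', Equiv.Perm.mul_apply, ih, Function.iterate_succ_apply']
    refine Prod.ext rfl ?_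
    change _ = col (D.arcOf (D.smooth s (D.otherEnd _)))
    rw [hcol, (D.arcOf_eq_iff _ _).2 (.inr (D.otherEnd_otherEnd ((D.walk s)^[n] h)).symm)]
    rfl

theorem IsCompatible.totalTwist_apply {col : D.ShortArc → Y} (hcol : D.IsCompatible s T col)
    (h : D.HalfEdge) :
    (T ^ D.totalTwist s h (Function.minimalPeriod (D.walk s) h)) (col (D.arcOf h)) =
      col (D.arcOf h) := by
  have := hcol.transport_pow (Function.minimalPeriod (D.walk s) h) h
  rw [D.transport_pow, Function.iterate_minimalPeriod] at this
  exact congrArg Prod.snd this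

/-- Two walks to the same half-edge differ by full turns around the loop, and a full turn fixes `y`.
-/
theorem transport_zpow_eq_of_fst_eq {h : D.HalfEdge} {y : Y}
    (hy : (T ^ D.totalTwist s h (Function.minimalPeriod (D.walk s) h)) y = y) {i j : ℤ}
    (hij : (D.walkPerm s ^ i) h = (D.walkPerm s ^ j) h) :
    (D.transport s T ^ i) (h, y) = (D.transport s T ^ j) (h, y) := by
  have hfix : (D.walkPerm s ^ (i - j)) h = h := by
    rw [sub_eq_neg_add, zpow_add, Equiv.Perm.mul_apply, hij, ← Equiv.Perm.mul_apply, ← zpow_add,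
      neg_add_cancel, zpow_zero, Equiv.Perm.one_apply]
  have hdvd : (Function.minimalPeriod (D.walk s) h : ℤ) ∣ i - j :=
    (MulAction.zpow_smul_eq_iff_minimalPeriod_dvd (a := D.walkPerm s) (b := h)).1 hfix
  obtain ⟨k, hk⟩ := hdvd
  have hp : (D.transport s T ^ Function.minimalPeriod (D.walk s) h) (h, y) = (h, y) := by
    rw [D.transport_pow, Function.iterate_minimalPeriod, hy]
  rw [← sub_add_cancel i j, add_comm, zpow_add, Equiv.Perm.mul_apply, hk, zpow_mul, zpow_natCast,
    Equiv.Perm.zpow_apply_eq_self_of_apply_eq_self hp]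

/-- The half-edge `h` is the rear or the front end of the arc reached, so passing its smoothing is
one step backwards or forwards. -/
theorem exists_transport_smooth {h₀ h : D.HalfEdge} {y : Y} {i : ℤ}
    (hi : D.arcOf ((D.transport s T ^ i) (h₀, y)).1 = D.arcOf h) :
    ∃ j : ℤ, D.arcOf ((D.transport s T ^ j) (h₀, y)).1 = D.arcOf (D.smooth s h) ∧
      ((D.transport s T ^ j) (h₀, y)).2 =
        (T ^ D.twist s h) ((D.transport s T ^ i) (h₀, y)).2 := by
  generalize hq : (D.transport s T ^ i) (h₀, y) = q at hi ⊢
  rw [arcOf_eq_iff] at hi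
  rcases hi with rfl | rfl
  · refine ⟨-1 + i, ?_, ?_⟩
    · rw [zpow_add, Equiv.Perm.mul_apply, hq, zpow_neg_one]
      exact (D.arcOf_eq_iff _ _).2 (.inr (D.otherEnd_otherEnd _).symm)
    · rw [zpow_add, Equiv.Perm.mul_apply, hq, zpow_neg_one]
      rfl
  · refine ⟨1 + i, ?_, ?_⟩
    · rw [zpow_add, Equiv.Perm.mul_apply, hq, zpow_one]
      rfl
    · rw [zpow_add, Equiv.Perm.mul_apply, hq, zpow_one]
      rfl

end Transport

/-! ### Counting compatible colorings loop by loop -/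

section LoopColoring

variable {Y : Type*} {D : Diagram} {s : D.State} {T : Equiv.Perm Y}

/-- The loop containing a short arc. -/
def loopOf (D : Diagram) (s : D.State) (e : D.ShortArc) : D.Loop s := Quot.mk _ e

theorem loopOf_out (C : D.Loop s) : D.loopOf s (Quot.out C) = C := Quot.out_eq C

theorem loopOf_smooth (h : D.HalfEdge) :
    D.loopOf s (D.arcOf (D.smooth s h)) = D.loopOf s (D.arcOf h) :=
  (Quot.sound ⟨h, rfl, rfl⟩).symm

/-- A property of short arcs that is passed on by the smoothings holds on a whole loop. -/
theorem forall_of_loopOf_eq {p : D.ShortArc → Prop}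
    (hp : ∀ h, p (D.arcOf h) → p (D.arcOf (D.smooth s h))) {e e' : D.ShortArc}
    (h : D.loopOf s e = D.loopOf s e') (he : p e) : p e' := by
  let P : D.Loop s → Prop := Quot.lift p (by
    rintro _ _ ⟨h, rfl, rfl⟩
    refine propext ⟨hp h, fun h' => ?_⟩
    have := hp _ h'
    rwa [smooth_smooth] at this)
  exact (congrArg P h).mp he

theorem zpow_apply_eq_iff_of_abs_eq {n m : ℤ} (h : |n| = |m|) (y : Y) :
    (T ^ n) y = y ↔ (T ^ m) y = y := by
  rcases abs_eq_abs.1 h with rfl | rfl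
  · rfl
  · rw [zpow_neg, Equiv.Perm.inv_eq_iff_eq, eq_comm]

theorem zpow_poleNumber_iff {C : D.Loop s} {x : D.Endpoint} (hC : Quot.out C = Sum.inl x) (y : Y) :
    (T ^ (2 * D.poleNumber s C : ℤ)) y = y ↔ (T ^ D.totalTwist s (x.1, x.2, .out)
      (Function.minimalPeriod (D.walk s) (x.1, x.2, .out))) y = y := by
  apply zpow_apply_eq_iff_of_abs_eq
  rw [abs_totalTwist, poleNumber, hC]
  exact abs_of_nonneg (by positivity)

theorem IsCompatible.zpow_poleNumber {col : D.ShortArc → Y} (hcol : D.IsCompatible s T col)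
    (C : D.Loop s) :
    (T ^ (2 * D.poleNumber s C : ℤ)) (col (Quot.out C)) = col (Quot.out C) := by
  rcases hC : Quot.out C with x | i
  · rw [zpow_poleNumber_iff hC]
    exact hcol.totalTwist_apply (x.1, x.2, .out)
  · simp [poleNumber, hC]

/-- The colors which an arc can receive by transport from the base point of a loop. -/
def Reaches (C : D.Loop s) (T : Equiv.Perm Y) (y : Y) (e : D.ShortArc) (v : Y) : Prop :=
  match Quot.out C with
  | Sum.inl x => ∃ i : ℤ, D.arcOf ((D.transport s T ^ i) ((x.1, x.2, .out), y)).1 = e ∧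
      ((D.transport s T ^ i) ((x.1, x.2, .out), y)).2 = v
  | Sum.inr i => e = Sum.inr i ∧ v = y

theorem reaches_out (C : D.Loop s) (y : Y) : Reaches C T y (Quot.out C) y := by
  unfold Reaches
  rcases Quot.out C with x | i
  · exact ⟨0, rfl, rfl⟩
  · exact ⟨rfl, rfl⟩

theorem Reaches.smooth {C : D.Loop s} {y : Y} {h : D.HalfEdge} {v : Y}
    (H : Reaches C T y (D.arcOf h) v) :
    Reaches C T y (D.arcOf (D.smooth s h)) ((T ^ D.twist s h) v) := by
  unfold Reaches at H ⊢
  rcases hC : Quot.out C with x | i <;> rw [hC] at H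
  · obtain ⟨i, hi, rfl⟩ := H
    exact exists_transport_smooth hi
  · obtain ⟨c, t, d⟩ := h
    cases d <;> exact absurd H.1 Sum.inl_ne_inr

/-- Transport is single-valued: an arc is only ever traversed in one direction, and the monodromy of
the loop, `T` to the power `± 2 a(C)`, fixes `y`. -/
theorem Reaches.eq {C : D.Loop s} {y : Y} (hy : (T ^ (2 * D.poleNumber s C : ℤ)) y = y)
    {e : D.ShortArc} {v v' : Y} (H : Reaches C T y e v) (H' : Reaches C T y e v') : v = v' := by
  unfold Reaches at H H'
  rcases hC : Quot.out C with x | i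
  · rw [zpow_poleNumber_iff hC] at hy
    rw [hC] at H H'
    obtain ⟨i, hi, rfl⟩ := H
    obtain ⟨j, hj, rfl⟩ := H'
    rw [← hj, transport_zpow_fst, transport_zpow_fst] at hi
    exact congrArg Prod.snd (transport_zpow_eq_of_fst_eq hy
      (D.walkPerm_zpow_eq_of_arcOf_eq s hi))
  · rw [hC] at H H'
    rw [H.2, H'.2]

theorem exists_reaches (e : D.ShortArc) (y : Y) : ∃ v, Reaches (D.loopOf s e) T y e v :=
  forall_of_loopOf_eq (p := fun e' => ∃ v, Reaches (D.loopOf s e) T y e' v)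
    (fun _ ⟨_, hv⟩ => ⟨_, hv.smooth⟩) (loopOf_out _) ⟨y, reaches_out _ y⟩

/-- Compatible colorings are determined by the colors of the base points of the loops. -/
theorem bijective_restrict_out :
    Function.Bijective (fun (col : {col // D.IsCompatible s T col}) (C : D.Loop s) =>
      (⟨col.1 (Quot.out C), col.2.zpow_poleNumber C⟩ :
        {y // (T ^ (2 * D.poleNumber s C : ℤ)) y = y})) := by
  constructor
  · intro col col' h
    ext e
    refine forall_of_loopOf_eq (p := fun e => col.1 e = col'.1 e) (fun h h' => ?_)
      (loopOf_out (D.loopOf s e)) (congrArg Subtype.val (congrFun h (D.loopOf s e)))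
    rw [col.2, col'.2, h']
  · intro y
    choose col hcol using fun e => exists_reaches (T := T) e (y (D.loopOf s e)).1
    refine ⟨⟨col, fun h => ?_⟩, funext fun C => Subtype.ext ?_⟩
    · have h₁ := hcol (D.arcOf (D.smooth s h))
      rw [loopOf_smooth] at h₁
      exact h₁.eq (y _).2 (hcol _).smooth
    · have h₁ := hcol (Quot.out C)
      rw [loopOf_out] at h₁
      exact h₁.eq (y C).2 (reaches_out _ _)

open Classical in
theorem card_isCompatible [Fintype Y] :
    Fintype.card {col // D.IsCompatible s T col} =
      ∏ C : D.Loop s, Fintype.card {y // (T ^ (2 * D.poleNumber s C : ℤ)) y = y} := by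
  rw [Fintype.card_of_bijective bijective_restrict_out, Fintype.card_pi]

end LoopColoring

/-! ### Expansion of the state sum over states -/

section StateExpansion

variable {R Y : Type*} [Field R] [DecidableEq Y] [Fintype Y] (D : Diagram) (A : Rˣ)
  (T : Equiv.Perm Y)

/-- The exponent of `A` contributed by a smoothing. -/
def _root_.VirtualLink.Smoothing.exponent : Smoothing → ℤ
  | .A => 1
  | .B => -1

theorem sum_exponent (s : D.State) :
    ∑ c, (s c).exponent = (D.alpha s : ℤ) - D.beta s := by
  rw [alpha, beta, Finset.card_filter, Finset.card_filter]
  push_cast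
  rw [← Finset.sum_sub_distrib]
  refine Finset.sum_congr rfl fun c _ => ?_
  cases s c <;> simp [Smoothing.exponent]

variable {D A T}

/-- Compatibility of a coloring with a smoothing at a crossing. -/
def IsCompatibleAt (T : Equiv.Perm Y) (col : D.ShortArc → Y) (c : D.Crossing) (σ : Smoothing) :
    Prop :=
  if (D.sign c = 1 ∧ σ = .A) ∨ (D.sign c = -1 ∧ σ = .B) then
    col (D.inArc (c, .over)) = col (D.outArc (c, .under)) ∧
      col (D.inArc (c, .under)) = col (D.outArc (c, .over))
  else
    col (D.inArc (c, .over)) = (T ^ (D.sign c : ℤ)) (col (D.inArc (c, .under))) ∧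
      (T ^ (D.sign c : ℤ)) (col (D.outArc (c, .over))) = col (D.outArc (c, .under))

theorem isCompatible_iff {s : D.State} {col : D.ShortArc → Y} :
    D.IsCompatible s T col ↔ ∀ c, IsCompatibleAt T col c (s c) := by
  have hfour {p : D.HalfEdge → Prop} : (∀ h, p h) ↔ ∀ c, p (c, .over, .inc) ∧ p (c, .over, .out) ∧
      p (c, .under, .inc) ∧ p (c, .under, .out) := by
    constructor
    · exact fun h c => ⟨h _, h _, h _, h _⟩
    · rintro h ⟨c, t, d⟩
      obtain ⟨h₁, h₂, h₃, h₄⟩ := h c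
      cases t <;> cases d <;> assumption
  rw [IsCompatible, hfour]
  refine forall_congr' fun c => ?_
  by_cases hc : D.IsOriented s c
  · have hc' := hc
    rw [IsOriented] at hc'
    simp only [IsCompatibleAt, if_pos hc', smooth, twist, pole, if_pos hc, Strand.flip, Dir.flip,
      arcOf, zpow_zero, Equiv.Perm.one_apply]
    constructor
    · rintro ⟨h₁, h₂, h₃, h₄⟩
      exact ⟨h₁.symm, h₂⟩
    · rintro ⟨h₁, h₂⟩
      exact ⟨h₁.symm, h₂, h₂.symm, h₁⟩
  · have hc' := hc
    rw [IsOriented] at hc'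
    simp only [IsCompatibleAt, if_neg hc', smooth, twist, pole, if_neg hc, Strand.flip, arcOf]
    obtain hs | hs := Int.units_eq_one_or (D.sign c) <;>
      simp [hs, Dir.sign, Side.weight, show (-1 : ℤˣ) ≠ 1 by decide]
    all_goals
      simp only [Equiv.eq_symm_apply, Equiv.symm_apply_eq]
      grind

open Classical in
theorem weightAt_eq_sum (col : D.ShortArc → Y) (c : D.Crossing) :
    D.weightAt A T col c = ∑ σ : Smoothing, ((A ^ σ.exponent : Rˣ) : R) *
      if IsCompatibleAt T col c σ then 1 else 0 := by
  rw [show (Finset.univ : Finset Smoothing) = {.A, .B} from rfl, Finset.sum_pair (by decide)]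
  obtain hs | hs := Int.units_eq_one_or (D.sign c) <;>
    simp [IsCompatibleAt, hs, weightAt, crossingWeight, planarWeight, Smoothing.exponent, ite_and,
      show (-1 : ℤˣ) ≠ 1 by decide] <;>
    split_ifs <;> ring

/-- Expanding the product of the weights chooses a smoothing at each crossing. For a fixed state the
sum counts compatible colorings, and these are counted by `card_isCompatible`. -/
theorem stateSum_eq_sum_states :
    D.stateSum A T = ∑ s : D.State, ((A ^ ((D.alpha s : ℤ) - D.beta s) : Rˣ) : R) *
      ∏ C : D.Loop s, (Fintype.card {y // (T ^ (2 * D.poleNumber s C : ℤ)) y = y} : R) := by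
  classical
  have hstate (s : D.State) : ∑ col : D.ShortArc → Y, ∏ c, ((A ^ (s c).exponent : Rˣ) : R) *
      (if IsCompatibleAt T col c (s c) then 1 else 0) =
      ((A ^ ((D.alpha s : ℤ) - D.beta s) : Rˣ) : R) *
      ∏ C : D.Loop s, (Fintype.card {y // (T ^ (2 * D.poleNumber s C : ℤ)) y = y} : R) := by
    have hA : ∏ c, ((A ^ (s c).exponent : Rˣ) : R) =
        ((A ^ ((D.alpha s : ℤ) - D.beta s) : Rˣ) : R) := by
      rw [← sum_exponent, ← Units.coe_prod]
      congr 1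
      induction (Finset.univ : Finset D.Crossing) using Finset.induction_on with
      | empty => simp
      | insert c P hc ih => rw [Finset.prod_insert hc, Finset.sum_insert hc, zpow_add, ih]
    simp only [Finset.prod_mul_distrib, hA, ← Finset.mul_sum, Fintype.prod_boole,
      ← isCompatible_iff]
    rw [Finset.sum_boole, ← Fintype.card_subtype]
    congr 1
    rw [← Nat.cast_prod]
    convert congrArg (Nat.cast (R := R)) (card_isCompatible (D := D) (s := s) (T := T))
  simp only [stateSum, weightAt_eq_sum, Finset.prod_univ_sum, Fintype.piFinset_univ]
  rw [Finset.sum_comm]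
  exact Finset.sum_congr rfl fun s _ => hstate s

end StateExpansion
end Diagram

/-! ### Detecting polynomials by their values -/

section Density

theorem laurentPolynomial_eq_zero_of_infinite {p : ℤ[T;T⁻¹]}
    (hp : {A : ℂˣ | LaurentPolynomial.eval₂ (Int.castRingHom ℂ) A p = 0}.Infinite) : p = 0 := by
  obtain ⟨n, f, hf⟩ := p.exists_T_pow
  have hroot : (f.map (Int.castRingHom ℂ)) = 0 := by
    refine Polynomial.eq_zero_of_infinite_isRoot _
      ((hp.image Units.val_injective.injOn).mono ?_)
    rintro _ ⟨A, hA, rfl⟩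
    have hA' : LaurentPolynomial.eval₂ (Int.castRingHom ℂ) A p = 0 := hA
    have := congrArg (LaurentPolynomial.eval₂ (Int.castRingHom ℂ) A) hf
    rw [LaurentPolynomial.eval₂_toLaurent, map_mul, hA', zero_mul] at this
    rwa [Set.mem_ofPred_eq, Polynomial.IsRoot.def, Polynomial.eval_map]
  have hf0 : f = 0 := by
    rwa [Polynomial.map_eq_zero_iff (RingHom.injective_int _)] at hroot
  rw [hf0, map_zero] at hf
  calc p = p * LaurentPolynomial.T n * LaurentPolynomial.T (-n) := by
        rw [mul_assoc, ← LaurentPolynomial.T_add, add_neg_cancel, LaurentPolynomial.T_zero, mul_one]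
    _ = 0 := by rw [← hf, zero_mul]

instance : CharZero ℤ[T;T⁻¹] :=
  ⟨fun a b h => by
    simpa using congrArg (LaurentPolynomial.eval₂ (Int.castRingHom ℚ) 1) h⟩

theorem exists_unit_of_loopValue (N : ℂ) :
    ∃ A : ℂˣ, N = -(A : ℂ) ^ 2 - ((A⁻¹ : ℂˣ) : ℂ) ^ 2 := by
  -- The square of `A` must be a root of `z² + N z + 1`; its discriminant is `s ^ 2`.
  obtain ⟨s, hs⟩ := IsAlgClosed.exists_pow_nat_eq (N ^ 2 - 4) (n := 2) (by norm_num)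
  obtain ⟨A, hA⟩ := IsAlgClosed.exists_pow_nat_eq ((-N + s) / 2) (n := 2) (by norm_num)
  have hquad : A ^ 2 * A ^ 2 + N * A ^ 2 + 1 = 0 := by
    rw [hA]; linear_combination hs / 4
  have hA0 : A ≠ 0 := by
    rintro rfl
    simp at hquad
  refine ⟨Units.mk0 A hA0, ?_⟩
  rw [Units.val_inv_eq_inv_val, Units.val_mk0]
  field_simp
  linear_combination hquad

theorem exists_sum_divisors_eq (v : ℕ → ℤ) :
    ∃ m : ℕ → ℤ, ∀ a > 0, ∑ d ∈ a.divisors, m d = v a :=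
  ⟨_, ArithmeticFunction.sum_eq_iff_sum_smul_moebius_eq.2 fun _ _ => rfl⟩

/-- Möbius inversion needs negative multiplicities, while `m` counts blocks. Viewed as a polynomial
`q` in the multiplicities, the evaluation vanishes on all natural values, hence identically, hence
at integers too. Then `p` vanishes at all points with coordinates in `c ℤ`. -/
theorem mvPolynomial_eq_zero_of_divisor_sums {S : Type*} [CommRing S] [IsDomain S] [CharZero S]
    {c : S} (hc : c ≠ 0) {p : MvPolynomial ℕ+ S}
    (hp : ∀ m : ℕ → ℕ, MvPolynomial.eval (fun a : ℕ+ => c * ∑ d ∈ (a : ℕ).divisors, (m d : S)) p = 0) :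
    p = 0 := by
  let q : MvPolynomial ℕ S :=
    MvPolynomial.bind₁ (fun a : ℕ+ => MvPolynomial.C c * ∑ d ∈ (a : ℕ).divisors, MvPolynomial.X d) p
  have hq (x : ℕ → S) : MvPolynomial.eval x q =
      MvPolynomial.eval (fun a : ℕ+ => c * ∑ d ∈ (a : ℕ).divisors, x d) p := by
    refine (MvPolynomial.eval₂Hom_bind₁ _ _ _ _).trans ?_
    congr 2
    funext a
    simp
  have hq0 : q = 0 := by
    refine MvPolynomial.funext_set (fun _ => Set.range (Nat.cast : ℕ → S))
      (fun _ => Set.infinite_range_of_injective Nat.cast_injective) fun x hx => ?_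
    choose m hm using fun i => hx i (Set.mem_univ i)
    obtain rfl : (fun i => (m i : S)) = x := funext hm
    rw [hq, hp, map_zero]
  refine MvPolynomial.funext_set (fun _ => Set.range fun z : ℤ => c * (z : S))
    (fun _ => Set.infinite_range_of_injective fun z z' h => ?_) fun x hx => ?_
  · exact_mod_cast mul_left_cancel₀ hc h
  · choose v hv using fun i => hx i (Set.mem_univ i)
    obtain ⟨m, hm⟩ := exists_sum_divisors_eq fun a => if h : 0 < a then v ⟨a, h⟩ else 0
    have := hq fun d => (m d : S)
    rw [hq0, map_zero] at this
    rw [map_zero, this]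
    congr 2
    funext a
    rw [← hv, ← Int.cast_sum, hm a a.pos, dif_pos a.pos]
    rfl

end Density

/-! ### Permutations with prescribed cycle lengths -/

section CyclicColors

variable (M : ℕ) (m : ℕ → ℕ)

/-- A finite set with `m d` blocks for each `d ≤ M + 1`; see `cyclicShift`. -/
abbrev CyclicColor : Type := (Σ d : Fin (M + 1), Fin (m (d + 1))) × ZMod (2 * (M + 1).factorial)

instance : NeZero (2 * (M + 1).factorial) :=
  ⟨Nat.mul_ne_zero two_ne_zero (Nat.factorial_ne_zero _)⟩

/-- The permutation which on the blocks for `d` has all cycles of length `2 * d`. -/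
def cyclicShift : Equiv.Perm (CyclicColor M m) :=
  Equiv.prodCongrRight fun p =>
    Equiv.addRight (((M + 1).factorial / (p.1 + 1) : ℕ) : ZMod (2 * (M + 1).factorial))

theorem cyclicShift_pow (n : ℕ) (y : CyclicColor M m) :
    (cyclicShift M m ^ n) y = (y.1, y.2 + ((n * ((M + 1).factorial / (y.1.1 + 1)) : ℕ) :
      ZMod (2 * (M + 1).factorial))) := by
  induction n with
  | zero => simp
  | succ n ih =>
    rw [pow_succ', Equiv.Perm.mul_apply, ih]
    simp [cyclicShift, add_mul, add_assoc]

theorem two_mul_dvd_two_mul_div_iff {F d : ℕ} (hF : F ≠ 0) (hd : d ∣ F) (a : ℕ) :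
    2 * F ∣ 2 * a * (F / d) ↔ d ∣ a := by
  obtain ⟨q, rfl⟩ := hd
  have hd0 : 0 < d := Nat.pos_of_ne_zero (left_ne_zero_of_mul hF)
  have hq0 : 0 < q := Nat.pos_of_ne_zero (right_ne_zero_of_mul hF)
  rw [Nat.mul_div_cancel_left _ hd0, mul_assoc, Nat.mul_dvd_mul_iff_left two_pos,
    Nat.mul_dvd_mul_iff_right hq0]

/-- Translation by `(M + 1)! / d` has order `2 * d` modulo `2 * (M + 1)!`; the factor `2` matches
the even exponents `2 * a`. -/
theorem cyclicShift_pow_eq_iff (a : ℕ) (y : CyclicColor M m) :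
    (cyclicShift M m ^ (2 * a : ℤ)) y = y ↔ (y.1.1 + 1 : ℕ) ∣ a := by
  rw [show (2 * a : ℤ) = ((2 * a : ℕ) : ℤ) by push_cast; rfl, zpow_natCast, cyclicShift_pow,
    Prod.ext_iff]
  simp only [true_and, add_eq_left]
  rw [ZMod.natCast_eq_zero_iff, two_mul_dvd_two_mul_div_iff (Nat.factorial_ne_zero _)
    (Nat.dvd_factorial (by omega) (by omega))]

theorem card_cyclicShift_fixed (a : ℕ) :
    Fintype.card {y // (cyclicShift M m ^ (2 * a : ℤ)) y = y} =
      2 * (M + 1).factorial * ∑ d ∈ Finset.Icc 1 (M + 1), if d ∣ a then m d else 0 := by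
  rw [Fintype.card_congr (Equiv.subtypeEquivRight (cyclicShift_pow_eq_iff M m a)),
    Fintype.card_subtype, Finset.card_filter, Fintype.sum_prod_type, Fintype.sum_sigma]
  calc _ = ∑ d : Fin (M + 1), ∑ _x : Fin (m (d + 1)), ∑ _z : ZMod (2 * (M + 1).factorial),
        (if (d + 1 : ℕ) ∣ a then 1 else 0) := rfl
    _ = ∑ d : Fin (M + 1), 2 * (M + 1).factorial * if (d + 1 : ℕ) ∣ a then m (d + 1) else 0 := by
      refine Finset.sum_congr rfl fun d _ => ?_
      simp only [Finset.sum_const, Finset.card_univ, ZMod.card, Fintype.card_fin, smul_eq_mul]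
      split_ifs <;> ring
    _ = _ := by
      rw [← Finset.mul_sum, Fin.sum_univ_eq_sum_range (fun d => if d + 1 ∣ a then m (d + 1) else 0),
        Finset.range_eq_Ico, Finset.sum_Ico_add' (fun d => if d ∣ a then m d else 0)]
      rfl

theorem card_cyclicColor :
    Fintype.card (CyclicColor M m) =
      2 * (M + 1).factorial * ∑ d ∈ Finset.Icc 1 (M + 1), m d := by
  have := card_cyclicShift_fixed M m 0
  rw [Fintype.card_subtype] at this
  simpa using this

end CyclicColors

namespace Diagram

/-! ### Comparison of the two brackets -/

section Defect

variable (D : Diagram)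

/-- The variables `K_i`, multiplied by the value of a loop. -/
def loopVariable (i : ℕ) : ArrowRing :=
  if h : 0 < i then MvPolynomial.X (⟨i, h⟩ : ℕ+) else MvPolynomial.C loopValue

/-- A multiple of the difference between the arrow bracket and the Kauffman bracket, in terms of
`loopVariable`. -/
def defect : ArrowRing :=
  ∑ s : D.State, MvPolynomial.C (LaurentPolynomial.T ((D.alpha s : ℤ) - D.beta s)) *
    (∏ C : D.Loop s, loopVariable (D.poleNumber s C) - MvPolynomial.C loopValue ^ D.loopCount s)

instance : Nonempty D.ShortArc := by
  rcases D.nonempty with ⟨⟨c⟩⟩ | h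
  · exact ⟨Sum.inl (c, .over)⟩
  · exact ⟨Sum.inr ⟨0, h⟩⟩

theorem loopCount_pos (s : D.State) : 0 < D.loopCount s :=
  Fintype.card_pos_iff.2 ⟨D.loopOf s (Classical.arbitrary _)⟩

theorem bind₁_defect :
    MvPolynomial.bind₁ (fun i => MvPolynomial.C loopValue * MvPolynomial.X i) D.defect =
      MvPolynomial.C loopValue * (D.dkmBracket - MvPolynomial.C D.kauffmanBracket) := by
  have hvar (i : ℕ) : MvPolynomial.bind₁
      (fun i => MvPolynomial.C loopValue * MvPolynomial.X i) (loopVariable i) =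
      MvPolynomial.C loopValue * K i := by
    by_cases h : 0 < i
    · rw [loopVariable, dif_pos h, K, dif_pos h]
      exact MvPolynomial.bind₁_X_right _ (⟨i, h⟩ : ℕ+)
    · rw [loopVariable, dif_neg h, K, dif_neg h, MvPolynomial.bind₁_C_right, mul_one]
  simp only [defect, dkmBracket, kauffmanBracket, map_sum, map_mul, map_sub, map_prod, map_pow,
    hvar, Finset.prod_mul_distrib, MvPolynomial.bind₁_C_right]
  rw [← Finset.sum_sub_distrib, Finset.mul_sum]
  refine Finset.sum_congr rfl fun s _ => ?_
  -- Every state has a loop, so the truncated exponent `|S| - 1` is the true one and a factor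
  -- `loopValue` splits off.
  rw [Finset.prod_const, Finset.card_univ, ← loopCount, stateWeight, evaluation,
    ← Nat.sub_add_cancel (D.loopCount_pos s), Nat.add_sub_cancel]
  simp only [map_mul, map_pow]
  ring

theorem loopValue_ne_zero : loopValue ≠ 0 := by
  intro h
  have := congrArg (LaurentPolynomial.eval₂ (Int.castRingHom ℚ) 1) h
  simp [loopValue, LaurentPolynomial.eval₂_T] at this
  norm_num at this

variable {D}

theorem AlmostClassical.eval_defect (hD : D.AlmostClassical) {M : ℕ}
    (hM : ∀ s C, D.poleNumber s C ≤ M) (m : ℕ → ℕ) :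
    MvPolynomial.eval (fun a : ℕ+ => ((2 * (M + 1).factorial : ℕ) : ℤ[T;T⁻¹]) *
      ∑ d ∈ (a : ℕ).divisors, (m d : ℤ[T;T⁻¹])) D.defect = 0 := by
  set f : ℕ+ → ℤ[T;T⁻¹] := fun a : ℕ+ => ((2 * (M + 1).factorial : ℕ) : ℤ[T;T⁻¹]) *
      ∑ d ∈ (a : ℕ).divisors, (m d : ℤ[T;T⁻¹])
  -- Blocks with `d = M + 1` contribute no fixed points to `T ^ (2 * a)` for `1 ≤ a ≤ M`, but they
  -- enlarge the color set. Varying `r` thus gives infinitely many `A` with the same values of the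
  -- variables, and `r + 1` keeps the color set nonempty.
  let m' (r d : ℕ) : ℕ := if d = M + 1 then r + 1 else m d
  have hm' {r d : ℕ} (hd : d ≤ M) : m' r d = m d := if_neg (by omega)
  choose A hA using fun r : ℕ => exists_unit_of_loopValue (Fintype.card (CyclicColor M (m' r)))
  have hcard (r : ℕ) : Fintype.card (CyclicColor M (m' r)) =
      2 * (M + 1).factorial * (∑ d ∈ Finset.Icc 1 M, m d + (r + 1)) := by
    rw [card_cyclicColor, Finset.sum_Icc_succ_top (by omega)]
    congr 2
    · exact Finset.sum_congr rfl fun d hd => hm' (Finset.mem_Icc.1 hd).2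
    · exact if_pos rfl
  have hinj : Function.Injective A := by
    intro r r' h
    have h₁ : (Fintype.card (CyclicColor M (m' r)) : ℂ) = Fintype.card (CyclicColor M (m' r')) := by
      rw [hA, hA, h]
    have h₂ := Nat.cast_injective h₁
    rw [hcard, hcard, Nat.mul_right_inj (NeZero.ne _)] at h₂
    omega
  refine laurentPolynomial_eq_zero_of_infinite
    ((Set.infinite_range_of_injective hinj).mono ?_)
  rintro _ ⟨r, rfl⟩
  have : Nonempty (CyclicColor M (m' r)) := by
    rw [← Fintype.card_pos_iff, hcard]
    positivity
  have key := hD.stateSum_eq (hA r) (cyclicShift M (m' r))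
  let ev := LaurentPolynomial.eval₂ (Int.castRingHom ℂ) (A r)
  have hT (n : ℤ) : ev (LaurentPolynomial.T n) = (((A r) ^ n : ℂˣ) : ℂ) :=
    LaurentPolynomial.eval₂_T _ _ n
  have hloop : ev loopValue = Fintype.card (CyclicColor M (m' r)) := by
    rw [hA, loopValue, map_sub, map_neg, hT, hT]
    simp [zpow_neg]
  have hvar (a : ℕ) (ha : a ≤ M) : ev (MvPolynomial.eval f (loopVariable a)) =
      Fintype.card {y // (cyclicShift M (m' r) ^ (2 * a : ℤ)) y = y} := by
    unfold loopVariable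
    split_ifs with h
    · refine (congrArg ev (MvPolynomial.eval_X (⟨a, h⟩ : ℕ+))).trans ?_
      rw [card_cyclicShift_fixed, ← Finset.sum_filter]
      have hfilter : Finset.filter (· ∣ a) (Finset.Icc 1 (M + 1)) = a.divisors := by
        ext d
        simp only [Finset.mem_filter, Finset.mem_Icc, Nat.mem_divisors]
        constructor
        · rintro ⟨-, h'⟩
          exact ⟨h', h.ne'⟩
        · rintro ⟨h', -⟩
          have := Nat.le_of_dvd h h'
          exact ⟨⟨Nat.pos_of_dvd_of_pos h' h, by omega⟩, h'⟩
      rw [hfilter, Finset.sum_congr rfl fun d hd => hm' ((Nat.divisor_le hd).trans ha)]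
      simp only [f, map_mul, map_sum, map_natCast, PNat.mk_coe]
      push_cast
      rfl
    · obtain rfl : a = 0 := by omega
      rw [MvPolynomial.eval_C, hloop, Fintype.card_subtype]
      simp
  rw [stateSum_eq_sum_states, stateSum_eq_sum_states, ← sub_eq_zero, ← Finset.sum_sub_distrib]
    at key
  rw [Set.mem_ofPred_eq, ← key]
  change ev _ = _
  simp only [defect, map_sum, map_mul, map_sub, map_prod, map_pow, MvPolynomial.eval_C, hT, hloop]
  refine Finset.sum_congr rfl fun s _ => ?_
  rw [mul_sub]
  congr 2
  · exact Finset.prod_congr rfl fun C _ => hvar _ (hM s C)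
  · simp [Fintype.card_subtype, loopCount]

theorem AlmostClassical.dkmBracket_eq (hD : D.AlmostClassical) :
    D.dkmBracket = MvPolynomial.C D.kauffmanBracket := by
  obtain ⟨M, hM⟩ : ∃ M, ∀ s C, D.poleNumber s C ≤ M :=
    ⟨∑ s, ∑ C, D.poleNumber s C, fun s C =>
      (Finset.single_le_sum (f := D.poleNumber s) (fun _ _ => Nat.zero_le _)
        (Finset.mem_univ C)).trans
      (Finset.single_le_sum (f := fun s => ∑ C, D.poleNumber s C) (fun _ _ => Nat.zero_le _)
        (Finset.mem_univ s))⟩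
  have h := D.bind₁_defect
  rw [mvPolynomial_eq_zero_of_divisor_sums (Nat.cast_ne_zero.2 (NeZero.ne _)) (hD.eval_defect hM),
    map_zero, eq_comm, mul_eq_zero, sub_eq_zero] at h
  exact h.resolve_left (by simpa using loopValue_ne_zero)

theorem AlmostClassical.dkmPolynomial_eq (hD : D.AlmostClassical) :
    D.dkmPolynomial = MvPolynomial.C D.normalizedKauffmanBracket := by
  rw [dkmPolynomial, normalizedKauffmanBracket, hD.dkmBracket_eq, map_mul]

/-- At `A = -1` modulo `3` the loop value is `-2 = 1`, so each of the `2 ^ n` states contributes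
`(-1) ^ n` and the bracket becomes `(-2) ^ n = 1`. -/
theorem kauffmanBracket_ne_zero : D.kauffmanBracket ≠ 0 := by
  intro h
  let ev := LaurentPolynomial.eval₂ (Int.castRingHom (ZMod 3)) (-1)
  have hT (n : ℤ) : ev (LaurentPolynomial.T n) = (((-1) ^ n : (ZMod 3)ˣ) : ZMod 3) :=
    LaurentPolynomial.eval₂_T _ _ n
  have hloop : ev loopValue = 1 := by
    rw [loopValue, map_sub, map_neg, hT, hT]
    decide
  have hstate (s : D.State) : ev (D.stateWeight s) = (-1) ^ Fintype.card D.Crossing := by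
    rw [stateWeight, map_mul, map_pow, hloop, one_pow, mul_one, hT, ← sum_exponent]
    have hexp (t : Finset D.Crossing) :
        (-1 : (ZMod 3)ˣ) ^ (∑ c ∈ t, (s c).exponent) = (-1) ^ t.card := by
      induction t using Finset.induction_on with
      | empty => rfl
      | insert c t hc ih =>
        rw [Finset.sum_insert hc, zpow_add, ih, Finset.card_insert_of_notMem hc, pow_succ']
        congr 1
        cases s c <;> rfl
    rw [hexp, Finset.card_univ]
    push_cast
    rfl
  have h' : ev D.kauffmanBracket = 1 := by
    have hS : Fintype.card Smoothing = 2 := rfl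
    simp only [kauffmanBracket, map_sum, hstate, Finset.sum_const, Finset.card_univ,
      Fintype.card_fun, hS, nsmul_eq_mul]
    push_cast
    rw [← mul_pow, show (2 : ZMod 3) * -1 = 1 by decide, one_pow]
  rw [h, map_zero] at h'
  exact absurd h' (by decide)

theorem AlmostClassical.as_eq (hD : D.AlmostClassical) : D.AS = {0} := by
  ext k
  simp only [AS, IsSurvivingState, hD.dkmBracket_eq, Set.mem_ofPred_eq, Set.mem_singleton_iff]
  constructor
  · rintro ⟨m, μ, h, rfl⟩
    by_cases hμ : 0 = μ
    · simp [← hμ, kDegree]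
    · simp [MvPolynomial.coeff_C, hμ] at h
  · rintro rfl
    obtain ⟨m, hm⟩ : ∃ m, D.kauffmanBracket.coeff m ≠ 0 := by
      by_contra! h
      refine kauffmanBracket_ne_zero (D := D) ?_
      ext m
      exact h m
    exact ⟨m, 0, by simpa using hm, by simp [kDegree]⟩

end Defect
end Diagram
end VirtualLink
end

theorem mainTheorem4 (D : VirtualLink.Diagram) (hD : D.AlmostClassical) :
    D.AS = {0} ∧
    D.dkmPolynomial = MvPolynomial.C D.normalizedKauffmanBracket := by exact
  ⟨hD.as_eq, hD.dkmPolynomial_eq⟩
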